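/- A topological groupoid $G$ with range and source maps $r,s\colon G\to G^{(0)}$ is called ample if it is locally compact, Hausdorff, étale (that is, $r$ and $s$ are local homeomorphisms onto $G^{(0)}$) and $G^{(0)}$ is totally disconnected. Let $G$ be an ample groupoid with compact unit space $G^{(0)}$. A bisection is a subset $S\subset G$ on which $r$ and $s$ are injective. The topological full group of $G$ is the group $$[[G]]=\{U\subset G \mid U \text{ is a compact open bisection with } r(U)=s(U)=G^{(0)}\}$$ under the product of sets of arrows, and $U\in[[G]]$ acts on $G^{(0)}$ by the homeomorphism $\theta_U=r\circ(s|_U)^{-1}$. Let $\mathrm C^*(G)$ be the full groupoid $\mathrm C^*$-algebra, that is, the completion of the convolution $*$-algebra $C_c(G)$ in the norm $\|f\|=\sup_\rho\|\rho(f)\|$, where $\rho$ runs over all nondegenerate $*$-representations of $C_c(G)$ by bounded operators on Hilbert spaces. Let $\pi\colon[[G]]\to \mathrm C^*(G)$ be the unitary representation $\pi(U)=1_U$, and let $\mathrm C^*_\pi([[G]])$ be the $\mathrm C^*$-subalgebra of $\mathrm C^*(G)$ generated by $\pi([[G]])$. The following four conditions are equivalent: (i) there is a regular Borel probability measure $\mu$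 on $G^{(0)}$ that is $G$-invariant, i.e. $\mu(r(S))=\mu(s(S))$ for every open bisection $S$ of $G$; (ii) $\pi$ weakly contains the trivial representation of $[[G]]$, i.e. $\left|\sum_i\alpha_i\right|\le\left\|\sum_i\alpha_i\pi(U_i)\right\|$ for every element $\sum_i\alpha_iU_i$ of the group algebra $\mathbb C[[G]]$; (iii) $\mathrm C^*_\pi([[G]])$ has a character, i.e. a nonzero multiplicative linear functional; (iv) there is a regular Borel probability measure $\mu$ on $G^{(0)}$ that is $[[G]]$-invariant, i.e. preserved by $\theta_U$ for every $U\in[[G]]$. -/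

import Mathlib

open Set Filter Topology MeasureTheory
open scoped CompactlySupported ENNReal

universe u v w

set_option linter.unusedSectionVars false

/-- A topological groupoid, presented as its space of arrows `G` together with the subset
`units = G⁽⁰⁾`, the range and source maps `r, s : G → G⁽⁰⁾`, the inversion and the partially
defined multiplication. The product `g * h` is meaningful only when `s g = r h`: nothing at all is
required of it, and it is never used, for other pairs. -/
class TopologicalGroupoid (G : Type u) [TopologicalSpace G] extends Mul G, Inv G where
  units : Set G
  r : G → units
  s : G → units
  r_unit : ∀ x : units, r (x : G) = x
  s_unit : ∀ x : units, s (x : G) = x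
  r_mul : ∀ g h : G, s g = r h → r (g * h) = r g
  s_mul : ∀ g h : G, s g = r h → s (g * h) = s h
  assoc : ∀ g h k : G, s g = r h → s h = r k → g * h * k = g * (h * k)
  unit_mul : ∀ g : G, (r g : G) * g = g
  mul_unit : ∀ g : G, g * (s g : G) = g
  r_inv : ∀ g : G, r g⁻¹ = s g
  s_inv : ∀ g : G, s g⁻¹ = r g
  mul_inv_eq : ∀ g : G, g * g⁻¹ = (r g : G)
  inv_mul_eq : ∀ g : G, g⁻¹ * g = (s g : G)
  continuousOn_mul : ContinuousOn (fun p : G × G => p.1 * p.2) {p | s p.1 = r p.2}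
  continuous_inversion : Continuous (fun g : G => g⁻¹)

open TopologicalGroupoid

/-- The unit space `G⁽⁰⁾ ⊆ G`, with the subspace topology. -/
abbrev UnitSpace (G : Type u) [TopologicalSpace G] [TopologicalGroupoid G] : Type u :=
  ↥(units : Set G)

/-- Ample groupoids: locally compact, Hausdorff, étale (`r` and `s` are local homeomorphisms onto
`G⁽⁰⁾`), with totally disconnected unit space. -/
class AmpleGroupoid (G : Type u) [TopologicalSpace G] [TopologicalGroupoid G] : Prop
    extends LocallyCompactSpace G, T2Space G where
  isLocalHomeomorph_r : IsLocalHomeomorph (r : G → UnitSpace G)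
  isLocalHomeomorph_s : IsLocalHomeomorph (s : G → UnitSpace G)
  totallyDisconnected : TotallyDisconnectedSpace (UnitSpace G)

attribute [instance] AmpleGroupoid.totallyDisconnected

/-- A bisection is a set of arrows on which `r` and `s` are injective. -/
def IsBisection {G : Type u} [TopologicalSpace G] [TopologicalGroupoid G] (S : Set G) : Prop :=
  InjOn (r : G → UnitSpace G) S ∧ InjOn (s : G → UnitSpace G) S

namespace AmpleGroupoid

section algebra

variable {G : Type u} [TopologicalSpace G] [TopologicalGroupoid G]

theorem inv_inv_arrow (g : G) : g⁻¹⁻¹ = g := by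
  have h1 : g⁻¹⁻¹ * g⁻¹ * g = g⁻¹⁻¹ * (g⁻¹ * g) :=
    assoc _ _ _ (s_inv _) (s_inv _)
  rw [inv_mul_eq g⁻¹, s_inv, unit_mul, inv_mul_eq, ← r_inv g, ← s_inv g⁻¹, mul_unit] at h1
  exact h1.symm

theorem inv_mul_cancel_left {g h : G} (e : r g = r h) : g * (g⁻¹ * h) = h := by
  rw [← assoc _ _ _ (r_inv g).symm ((s_inv g).trans e), mul_inv_eq, e, unit_mul]

theorem mul_inv_cancel_left {g h : G} (e : s g = r h) : g⁻¹ * (g * h) = h := by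
  rw [← assoc _ _ _ (s_inv g) e, inv_mul_eq, e, unit_mul]

theorem mul_inv_cancel_right {g h : G} (e : s g = r h) : g * h * h⁻¹ = g := by
  rw [assoc _ _ _ e (r_inv h).symm, mul_inv_eq, ← e, mul_unit]

theorem mul_inv_rev {g h : G} (e : s g = r h) : (g * h)⁻¹ = h⁻¹ * g⁻¹ := by
  have e2 : s h⁻¹ = r g⁻¹ := by rw [s_inv, r_inv, e]
  have h1 : g * h * (h⁻¹ * g⁻¹) = (r (g * h) : G) := by
    rw [← assoc _ _ _ (by rw [s_mul _ _ e, r_inv]) e2, mul_inv_cancel_right e, mul_inv_eq,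
      r_mul _ _ e]
  have h2 := mul_inv_cancel_left (g := g * h) (h := h⁻¹ * g⁻¹)
    (by rw [s_mul _ _ e, r_mul _ _ e2, r_inv])
  rw [h1, ← s_inv, mul_unit] at h2
  exact h2

theorem unit_inv (x : UnitSpace G) : (x : G)⁻¹ = x := by
  have h := unit_mul (x : G)⁻¹
  rw [r_inv, s_unit, mul_inv_eq, r_unit] at h
  exact h.symm

theorem continuous_r : Continuous (r : G → UnitSpace G) := by
  rw [Topology.IsInducing.subtypeVal.continuous_iff]
  have : (Subtype.val ∘ (r : G → UnitSpace G)) =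
      (fun p : G × G => p.1 * p.2) ∘ fun g : G => (g, g⁻¹) := by
    funext g; exact (mul_inv_eq g).symm
  rw [this]
  exact continuousOn_mul.comp_continuous (continuous_id.prodMk continuous_inversion)
    (fun g => (r_inv g).symm)

theorem continuous_s : Continuous (s : G → UnitSpace G) := by
  have : (s : G → UnitSpace G) = r ∘ fun g : G => g⁻¹ := by
    funext g; exact (r_inv g).symm
  rw [this]
  exact continuous_r.comp continuous_inversion

/-- The product `{gh : g ∈ U, h ∈ V, s g = r h}` of two sets of arrows. -/
def setMul (U V : Set G) : Set G :=
  {γ | ∃ g ∈ U, ∃ h ∈ V, s g = r h ∧ g * h = γ}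

/-- The set of inverses of the elements of `U`. -/
def setInv (U : Set G) : Set G := {γ | γ⁻¹ ∈ U}

end algebra

section convolution

variable {G : Type u} [TopologicalSpace G] [TopologicalGroupoid G]

/-- The ways of writing `γ` as a product of two composable arrows. -/
abbrev Factor (γ : G) : Type u := {p : G × G // s p.1 = r p.2 ∧ p.1 * p.2 = γ}

/-- Convolution, `(f ⋆ g)(γ) = ∑_{αβ = γ} f(α) g(β)`. For `f` in `C_c(G)` and `G` étale this sum
has only finitely many nonzero terms. -/
noncomputable def convFun (f g : G → ℂ) (γ : G) : ℂ :=
  ∑ᶠ p : Factor γ, f p.1.1 * g p.1.2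

theorem factor_r {γ : G} (p : Factor γ) : r p.1.1 = r γ := by
  have h := r_mul _ _ p.2.1
  rw [p.2.2] at h
  exact h.symm

theorem factor_ext {γ : G} (p q : Factor γ) (h : p.1.1 = q.1.1) : p = q := by
  have hp := mul_inv_cancel_left p.2.1
  have hq := mul_inv_cancel_left q.2.1
  rw [p.2.2] at hp
  rw [q.2.2, ← h, hp] at hq
  exact Subtype.ext (Prod.ext h hq)

/-- The factorization of `γ` with a given first factor. -/
def factorOf {α γ : G} (h : r α = r γ) : Factor γ :=
  ⟨(α, α⁻¹ * γ), by
    rw [r_mul _ _ ((s_inv α).trans h), r_inv], inv_mul_cancel_left h⟩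

theorem convFun_of_mem {f : G → ℂ} {U : Set G} (hU : IsBisection U)
    (hf : ∀ x ∉ U, f x = 0) (g : G → ℂ) {α γ : G} (hα : α ∈ U) (h : r α = r γ) :
    convFun f g γ = f α * g (α⁻¹ * γ) := by
  refine finsum_eq_single _ (factorOf h) fun p hp => ?_
  have : p.1.1 ∉ U := fun hpU => hp (factor_ext _ _ (hU.1 hpU hα ((factor_r p).trans h.symm)))
  rw [hf _ this, zero_mul]

theorem convFun_of_notMem {f : G → ℂ} {U : Set G}
    (hf : ∀ x ∉ U, f x = 0) (g : G → ℂ) {γ : G} (h : ∀ α ∈ U, r α ≠ r γ) :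
    convFun f g γ = 0 := by
  refine finsum_eq_zero_of_forall_eq_zero fun p => ?_
  rw [hf _ fun hp => h _ hp (factor_r p), zero_mul]

end convolution

section ample

variable {G : Type u} [TopologicalSpace G] [TopologicalGroupoid G] [AmpleGroupoid G]
  [CompactSpace (UnitSpace G)]

theorem exists_bisection {g : G} {W : Set G} (hW : IsOpen W) (hg : g ∈ W) :
    ∃ U : Set G, IsOpen U ∧ IsCompact U ∧ IsBisection U ∧ g ∈ U ∧ U ⊆ W := by
  obtain ⟨e, hge, he⟩ := isLocalHomeomorph_r g
  obtain ⟨e', hge', he'⟩ := isLocalHomeomorph_s g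
  set V : Set G := W ∩ e.source ∩ e'.source with hV
  have hVo : IsOpen V := (hW.inter e.open_source).inter e'.open_source
  have hVe : V ⊆ e.source := fun x hx => hx.1.2
  have himg : IsOpen (e '' V) := e.isOpen_image_of_subset_source hVo hVe
  obtain ⟨C, hC, hgC, hCV⟩ := compact_exists_isClopen_in_isOpen himg
    (mem_image_of_mem e (⟨⟨hg, hge⟩, hge'⟩ : g ∈ V))
  have hCt : C ⊆ e.target := by
    rintro _ hx
    obtain ⟨y, hy, rfl⟩ := hCV hx
    exact e.map_source (hVe hy)
  have hsub : e.symm '' C ⊆ V := by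
    rintro _ ⟨x, hx, rfl⟩
    obtain ⟨y, hy, rfl⟩ := hCV hx
    rwa [e.left_inv (hVe hy)]
  refine ⟨e.symm '' C, e.symm.isOpen_image_of_subset_source hC.isOpen hCt,
    hC.isClosed.isCompact.image_of_continuousOn (e.symm.continuousOn.mono hCt), ⟨?_, ?_⟩,
    ⟨e g, hgC, e.left_inv hge⟩, fun x hx => (hsub hx).1.1⟩
  · rw [he]; exact e.injOn.mono fun x hx => hVe (hsub hx)
  · rw [he']; exact e'.injOn.mono fun x hx => (hsub hx).2

/-- The indicator function of a compact open set, times a continuous function. -/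
noncomputable def cutoff (U : Set G) (hU : IsOpen U) (hUc : IsCompact U) (f : C(G, ℂ)) :
    C_c(G, ℂ) where
  toFun := U.indicator f
  continuous_toFun := f.continuous.indicator fun x hx => by
    rw [(IsClopen.frontier_eq ⟨hUc.isClosed, hU⟩ : frontier U = ∅)] at hx
    exact hx.elim
  hasCompactSupport' := HasCompactSupport.intro hUc fun _ hx => indicator_of_notMem hx _

/-- The function `1_U ∈ C_c(G)`, for a compact open set `U`. -/
noncomputable def ind (U : Set G) (hU : IsOpen U) (hUc : IsCompact U) : C_c(G, ℂ) :=
  cutoff U hU hUc 1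

theorem ind_apply {U : Set G} (hU : IsOpen U) (hUc : IsCompact U) (x : G) :
    ind U hU hUc x = U.indicator 1 x := rfl

/-- Elements of `C_c(G)` are finite sums of ones that live on compact open bisections. -/
theorem cc_induction {P : C_c(G, ℂ) → Prop} (hz : P 0) (ha : ∀ f g, P f → P g → P (f + g))
    (hs : ∀ U : Set G, IsOpen U → IsCompact U → IsBisection U →
      ∀ f : C_c(G, ℂ), (∀ x ∉ U, f x = 0) → P f) (f : C_c(G, ℂ)) : P f := by
  choose U hUo hUc hUb hUm _ using fun g : G => exists_bisection isOpen_univ (mem_univ g)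
  obtain ⟨t, ht⟩ := f.hasCompactSupport.isCompact.elim_finite_subcover U hUo
    (fun x _ => mem_iUnion.2 ⟨x, hUm x⟩)
  have key : ∀ t : Finset G, ∀ f : C_c(G, ℂ), (∀ x ∉ ⋃ i ∈ t, U i, f x = 0) → P f := by
    classical
    intro t
    induction t using Finset.induction_on with
    | empty =>
      intro f hf
      have : f = 0 := CompactlySupportedContinuousMap.ext fun x => hf x (by simp)
      rwa [this]
    | insert a t _ ih =>
      intro f hf
      set f₁ := cutoff (U a) (hUo a) (hUc a) f.toContinuousMap with hf₁
      have e1 : ∀ x, f₁ x = (U a).indicator f x := fun _ => rfl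
      have : f = f₁ + (f - f₁) := by abel
      rw [this]
      refine ha _ _ (hs _ (hUo a) (hUc a) (hUb a) _ fun x hx => ?_) (ih _ fun x hx => ?_)
      · rw [e1, indicator_of_notMem hx]
      · rw [CompactlySupportedContinuousMap.sub_apply, e1]
        by_cases hxa : x ∈ U a
        · rw [indicator_of_mem hxa, sub_self]
        · rw [indicator_of_notMem hxa, sub_zero]
          refine hf x ?_
          rw [Finset.set_biUnion_insert]
          exact fun h => h.elim hxa hx
  exact key t f fun x hx => image_eq_zero_of_notMem_tsupport fun h => hx (ht h)

theorem factor_finite (f : C_c(G, ℂ)) (γ : G) : {p : Factor γ | f p.1.1 ≠ 0}.Finite := by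
  induction f using cc_induction with
  | hz => simp
  | ha f g hf hg =>
    refine (hf.union hg).subset fun p hp => ?_
    by_contra h
    simp only [mem_union, mem_ofPred_eq, not_or, not_not] at h
    exact hp (by rw [CompactlySupportedContinuousMap.add_apply, h.1, h.2, add_zero])
  | hs U _ _ hU f hf =>
    refine Set.Subsingleton.finite fun p hp q hq => factor_ext _ _ ?_
    have hpU : p.1.1 ∈ U := by_contra fun h => hp (hf _ h)
    have hqU : q.1.1 ∈ U := by_contra fun h => hq (hf _ h)
    exact hU.1 hpU hqU ((factor_r p).trans (factor_r q).symm)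

theorem convFun_add (f₁ f₂ : C_c(G, ℂ)) (g : G → ℂ) :
    convFun (f₁ + f₂ : C_c(G, ℂ)) g = convFun f₁ g + convFun f₂ g := by
  funext γ
  have h : ∀ f : C_c(G, ℂ), (Function.support fun p : Factor γ => f p.1.1 * g p.1.2).Finite :=
    fun f => (factor_finite f γ).subset fun p hp => left_ne_zero_of_mul hp
  rw [Pi.add_apply, convFun, convFun, convFun, ← finsum_add_distrib (h f₁) (h f₂)]
  exact finsum_congr fun p => by rw [CompactlySupportedContinuousMap.add_apply, add_mul]

theorem continuous_convFun (f g : C_c(G, ℂ)) : Continuous (convFun f g) := by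
  induction f using cc_induction with
  | hz =>
    have : convFun (0 : C_c(G, ℂ)) g = fun _ => 0 := by
      funext γ; simp [convFun]
    rw [this]; exact continuous_const
  | ha f₁ f₂ h₁ h₂ => rw [convFun_add]; exact h₁.add h₂
  | hs U hUo hUc hU f hf =>
    rw [continuous_iff_continuousAt]
    intro γ
    by_cases hγ : ∃ α ∈ U, r α = r γ
    · obtain ⟨α, hα, hr⟩ := hγ
      obtain ⟨e, hαe, he⟩ := isLocalHomeomorph_r α
      have hrt : r γ ∈ e.target := by
        rw [← hr, he]; exact e.map_source hαe
      have hes : e.symm (r γ) = α := by rw [← hr, he, e.left_inv hαe]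
      have hσ : ContinuousAt (fun x : G => e.symm (r x)) γ :=
        ContinuousAt.comp (e.continuousAt_symm hrt) continuous_r.continuousAt
      have hσr : ∀ᶠ x in 𝓝 γ, r (e.symm (r x)) = r x := by
        have := continuous_r.continuousAt.eventually (e.open_target.mem_nhds hrt)
        filter_upwards [this] with x hx
        rw [he] at hx ⊢
        exact e.right_inv hx
      have hσU : ∀ᶠ x in 𝓝 γ, e.symm (r x) ∈ U :=
        hσ.eventually (hUo.mem_nhds (by simpa only [hes] using hα))
      have hev : (fun x => f (e.symm (r x)) * g ((e.symm (r x))⁻¹ * x)) =ᶠ[𝓝 γ]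
          convFun f g := by
        filter_upwards [hσr, hσU] with x h1 h2
        rw [convFun_of_mem hU hf g h2 h1]
      refine ContinuousAt.congr ?_ hev
      have hpair : ContinuousAt (fun x : G => ((e.symm (r x))⁻¹, x)) γ :=
        (continuous_inversion.continuousAt.comp hσ).prodMk continuousAt_id
      have hmem : (((e.symm (r γ))⁻¹, γ) : G × G) ∈ {p : G × G | s p.1 = r p.2} := by
        change s (e.symm (r γ))⁻¹ = r γ
        rw [s_inv, hes, hr]
      have hm : ContinuousAt (fun x : G => (e.symm (r x))⁻¹ * x) γ := by
        refine (continuousOn_mul _ hmem).tendsto.comp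
          (tendsto_nhdsWithin_iff.2 ⟨hpair, ?_⟩)
        filter_upwards [hσr] with x hx
        rw [s_inv, hx]
      exact (f.1.continuous.continuousAt.comp hσ).mul
        (ContinuousAt.comp (g := g) g.1.continuous.continuousAt hm)
    · have hcl : IsClosed ((r : G → UnitSpace G) ⁻¹' (r '' U)) :=
        (hUc.image continuous_r).isClosed.preimage continuous_r
      have hev : (fun _ => (0 : ℂ)) =ᶠ[𝓝 γ] convFun f g := by
        filter_upwards [hcl.isOpen_compl.mem_nhds hγ] with x hx
        exact (convFun_of_notMem hf g fun α hα h => hx ⟨α, hα, h⟩).symm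
      exact continuousAt_const.congr hev

theorem isCompact_setMul {K L : Set G} (hK : IsCompact K) (hL : IsCompact L) :
    IsCompact (setMul K L) := by
  have hcl : IsClosed {p : G × G | s p.1 = r p.2} :=
    isClosed_eq (continuous_s.comp continuous_fst) (continuous_r.comp continuous_snd)
  have := ((hK.prod hL).inter_right hcl).image_of_continuousOn
    (continuousOn_mul.mono inter_subset_right)
  convert this using 1
  ext γ
  constructor
  · rintro ⟨g, hg, h, hh, e, rfl⟩
    exact ⟨(g, h), ⟨⟨hg, hh⟩, e⟩, rfl⟩
  · rintro ⟨⟨g, h⟩, ⟨⟨hg, hh⟩, e⟩, rfl⟩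
    exact ⟨g, hg, h, hh, e, rfl⟩

/-- The convolution product of `C_c(G)`. -/
noncomputable def conv (f g : C_c(G, ℂ)) : C_c(G, ℂ) where
  toFun := convFun f g
  continuous_toFun := continuous_convFun f g
  hasCompactSupport' := by
    refine HasCompactSupport.intro
      (isCompact_setMul f.hasCompactSupport.isCompact g.hasCompactSupport.isCompact)
      fun γ hγ => finsum_eq_zero_of_forall_eq_zero fun p => ?_
    by_contra h
    exact hγ ⟨p.1.1, subset_tsupport _ (left_ne_zero_of_mul h), p.1.2,
      subset_tsupport _ (right_ne_zero_of_mul h), p.2⟩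

/-- The inversion of `G` as a homeomorphism. -/
def invHomeo : G ≃ₜ G where
  toFun g := g⁻¹
  invFun g := g⁻¹
  left_inv := inv_inv_arrow
  right_inv := inv_inv_arrow
  continuous_toFun := continuous_inversion
  continuous_invFun := continuous_inversion

/-- The involution of `C_c(G)`, `f^*(γ) = conj (f (γ⁻¹))`. -/
noncomputable def invol (f : C_c(G, ℂ)) : C_c(G, ℂ) where
  toFun γ := star (f γ⁻¹)
  continuous_toFun := continuous_star.comp (f.1.continuous.comp continuous_inversion)
  hasCompactSupport' :=
    (f.hasCompactSupport.comp_homeomorph (invHomeo : G ≃ₜ G)).comp_left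
      (g := fun z : ℂ => star z) (star_zero ℂ)

theorem conv_apply (f g : C_c(G, ℂ)) (γ : G) : conv f g γ = convFun f g γ := rfl

theorem invol_apply (f : C_c(G, ℂ)) (γ : G) : invol f γ = star (f γ⁻¹) := rfl

theorem isOpen_units : IsOpen (units : Set G) := by
  rw [isOpen_iff_mem_nhds]
  intro x hx
  obtain ⟨e, hxe, he⟩ := isLocalHomeomorph_r x
  have hrx : ((r x : UnitSpace G) : G) = x := congrArg Subtype.val (r_unit ⟨x, hx⟩)
  have h2 : ∀ᶠ g in 𝓝 x, ((r g : UnitSpace G) : G) ∈ e.source :=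
    (continuous_subtype_val.comp continuous_r).continuousAt.eventually
      (e.open_source.mem_nhds (by simpa [hrx] using hxe))
  filter_upwards [e.open_source.mem_nhds hxe, h2] with g h1 h2
  have : ((r g : UnitSpace G) : G) = g := e.injOn h2 h1 (by rw [← he, r_unit])
  rw [← this]
  exact (r g).2

theorem isCompact_units : IsCompact (units : Set G) := isCompact_iff_compactSpace.2 inferInstance

theorem isBisection_units : IsBisection (units : Set G) := by
  refine ⟨fun x hx y hy h => ?_, fun x hx y hy h => ?_⟩
  · have := (r_unit ⟨x, hx⟩).symm.trans (h.trans (r_unit ⟨y, hy⟩))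
    exact congrArg Subtype.val this
  · have := (s_unit ⟨x, hx⟩).symm.trans (h.trans (s_unit ⟨y, hy⟩))
    exact congrArg Subtype.val this

variable (G) in
/-- The function `1_{G⁽⁰⁾}`, which is the unit of `C_c(G)`. -/
noncomputable def unitFun : C_c(G, ℂ) := ind units isOpen_units isCompact_units

/-- The product of two compact open bisections corresponds to convolution. -/
theorem convFun_ind {U V : Set G} (hU : IsBisection U)
    (hUo : IsOpen U) (hUc : IsCompact U) (hVo : IsOpen V) (hVc : IsCompact V) (γ : G) :
    convFun (ind U hUo hUc) (ind V hVo hVc) γ = (setMul U V).indicator 1 γ := by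
  have hz : ∀ x ∉ U, ind U hUo hUc x = 0 := fun x hx => by
    rw [ind_apply, indicator_of_notMem hx]
  by_cases hγ : ∃ α ∈ U, r α = r γ
  · obtain ⟨α, hα, hr⟩ := hγ
    rw [convFun_of_mem hU hz _ hα hr, ind_apply, ind_apply, indicator_of_mem hα, Pi.one_apply,
      one_mul]
    by_cases h : α⁻¹ * γ ∈ V
    · rw [indicator_of_mem h, indicator_of_mem, Pi.one_apply, Pi.one_apply]
      exact ⟨α, hα, _, h, (factorOf hr).2⟩
    · rw [indicator_of_notMem h, indicator_of_notMem]
      rintro ⟨g, hg, k, hk, e, rfl⟩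
      have : α = g := hU.1 hα hg (by rw [hr, r_mul _ _ e])
      subst this
      rw [mul_inv_cancel_left e] at h
      exact h hk
  · rw [convFun_of_notMem hz _ fun α hα h => hγ ⟨α, hα, h⟩, indicator_of_notMem]
    rintro ⟨g, hg, k, hk, e, rfl⟩
    exact hγ ⟨g, hg, (r_mul _ _ e).symm⟩

theorem isOpen_setMul {U V : Set G} (hU : IsBisection U) (hUo : IsOpen U) (hUc : IsCompact U)
    (hVo : IsOpen V) (hVc : IsCompact V) : IsOpen (setMul U V) := by
  have h : setMul U V = convFun (ind U hUo hUc) (ind V hVo hVc) ⁻¹' {0}ᶜ := by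
    ext γ
    rw [mem_preimage, convFun_ind hU]
    by_cases h : γ ∈ setMul U V <;> simp [h]
  rw [h]
  exact isOpen_compl_singleton.preimage (continuous_convFun _ _)

theorem conv_ind {U V : Set G} (hU : IsBisection U)
    (hUo : IsOpen U) (hUc : IsCompact U) (hVo : IsOpen V) (hVc : IsCompact V) :
    conv (ind U hUo hUc) (ind V hVo hVc) =
      ind (setMul U V) (isOpen_setMul hU hUo hUc hVo hVc) (isCompact_setMul hUc hVc) :=
  CompactlySupportedContinuousMap.ext fun γ => convFun_ind hU hUo hUc hVo hVc γ

end ample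

end AmpleGroupoid

open AmpleGroupoid

section fullgroup

variable (G : Type u) [TopologicalSpace G] [TopologicalGroupoid G]

/-- The topological full group `[[G]]`: the compact open bisections `U` with
`r(U) = s(U) = G⁽⁰⁾`. -/
@[ext] structure TopologicalFullGroup : Type u where
  carrier : Set G
  isOpen : IsOpen carrier
  isCompact : IsCompact carrier
  isBisection : IsBisection carrier
  r_image : (r : G → UnitSpace G) '' carrier = univ
  s_image : (s : G → UnitSpace G) '' carrier = univ

namespace TopologicalFullGroup

variable {G}

theorem exists_s (U : TopologicalFullGroup G) (x : UnitSpace G) : ∃ g ∈ U.carrier, s g = x := by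
  have : x ∈ (s : G → UnitSpace G) '' U.carrier := U.s_image ▸ mem_univ x
  exact this

theorem exists_r (U : TopologicalFullGroup G) (x : UnitSpace G) : ∃ g ∈ U.carrier, r g = x := by
  have : x ∈ (r : G → UnitSpace G) '' U.carrier := U.r_image ▸ mem_univ x
  exact this

/-- The homeomorphism `θ_U = r ∘ (s|_U)⁻¹` of `G⁽⁰⁾` given by `U ∈ [[G]]`. -/
noncomputable def theta (U : TopologicalFullGroup G) (x : UnitSpace G) : UnitSpace G :=
  r (U.exists_s x).choose

theorem theta_s (U : TopologicalFullGroup G) {g : G} (hg : g ∈ U.carrier) :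
    U.theta (s g) = r g := by
  have h := (U.exists_s (s g)).choose_spec
  exact congrArg r (U.isBisection.2 h.1 hg h.2)

variable [AmpleGroupoid G] [CompactSpace (UnitSpace G)]

/-- The product of `[[G]]` is the product of sets of arrows. -/
instance : Mul (TopologicalFullGroup G) where
  mul U V :=
    { carrier := setMul U.carrier V.carrier
      isOpen := isOpen_setMul U.isBisection U.isOpen U.isCompact V.isOpen V.isCompact
      isCompact := isCompact_setMul U.isCompact V.isCompact
      isBisection := by
        constructor
        · rintro _ ⟨g, hg, h, hh, e, rfl⟩ _ ⟨g', hg', h', hh', e', rfl⟩ hr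
          rw [r_mul _ _ e, r_mul _ _ e'] at hr
          obtain rfl := U.isBisection.1 hg hg' hr
          obtain rfl := V.isBisection.1 hh hh' (e.symm.trans e')
          rfl
        · rintro _ ⟨g, hg, h, hh, e, rfl⟩ _ ⟨g', hg', h', hh', e', rfl⟩ hs
          rw [s_mul _ _ e, s_mul _ _ e'] at hs
          obtain rfl := V.isBisection.2 hh hh' hs
          obtain rfl := U.isBisection.2 hg hg' (e.trans e'.symm)
          rfl
      r_image := by
        refine eq_univ_of_forall fun x => ?_
        obtain ⟨g, hg, rfl⟩ := U.exists_r x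
        obtain ⟨h, hh, e⟩ := V.exists_r (s g)
        exact ⟨g * h, ⟨g, hg, h, hh, e.symm, rfl⟩, r_mul _ _ e.symm⟩
      s_image := by
        refine eq_univ_of_forall fun x => ?_
        obtain ⟨h, hh, rfl⟩ := V.exists_s x
        obtain ⟨g, hg, e⟩ := U.exists_s (r h)
        exact ⟨g * h, ⟨g, hg, h, hh, e, rfl⟩, s_mul _ _ e⟩ }

/-- The unit of `[[G]]` is `G⁽⁰⁾`. -/
instance : One (TopologicalFullGroup G) where
  one :=
    { carrier := units
      isOpen := isOpen_units
      isCompact := isCompact_units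
      isBisection := isBisection_units
      r_image := eq_univ_of_forall fun x => ⟨x, x.2, r_unit x⟩
      s_image := eq_univ_of_forall fun x => ⟨x, x.2, s_unit x⟩ }

/-- The inverse of `U` in `[[G]]` is `{g⁻¹ : g ∈ U}`. -/
instance : Inv (TopologicalFullGroup G) where
  inv U :=
    { carrier := setInv U.carrier
      isOpen := U.isOpen.preimage continuous_inversion
      isCompact := (invHomeo (G := G)).isCompact_preimage.2 U.isCompact
      isBisection := by
        constructor
        · intro g hg h hh e
          have := U.isBisection.2 hg hh (by rw [s_inv, s_inv, e])
          rw [← inv_inv_arrow g, this, inv_inv_arrow]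
        · intro g hg h hh e
          have := U.isBisection.1 hg hh (by rw [r_inv, r_inv, e])
          rw [← inv_inv_arrow g, this, inv_inv_arrow]
      r_image := by
        refine eq_univ_of_forall fun x => ?_
        obtain ⟨g, hg, rfl⟩ := U.exists_s x
        exact ⟨g⁻¹, by rwa [setInv, mem_ofPred_eq, inv_inv_arrow], r_inv g⟩
      s_image := by
        refine eq_univ_of_forall fun x => ?_
        obtain ⟨g, hg, rfl⟩ := U.exists_r x
        exact ⟨g⁻¹, by rwa [setInv, mem_ofPred_eq, inv_inv_arrow], s_inv g⟩ }

theorem carrier_mul (U V : TopologicalFullGroup G) :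
    (U * V).carrier = setMul U.carrier V.carrier := rfl

theorem carrier_one : (1 : TopologicalFullGroup G).carrier = units := rfl

theorem carrier_inv (U : TopologicalFullGroup G) : U⁻¹.carrier = setInv U.carrier := rfl

instance : Group (TopologicalFullGroup G) where
  mul_assoc U V W := by
    ext γ
    simp only [carrier_mul]
    constructor
    · rintro ⟨_, ⟨g, hg, h, hh, e, rfl⟩, k, hk, e', rfl⟩
      rw [s_mul _ _ e] at e'
      exact ⟨g, hg, h * k, ⟨h, hh, k, hk, e', rfl⟩, by rw [r_mul _ _ e', e],
        (assoc _ _ _ e e').symm⟩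
    · rintro ⟨g, hg, _, ⟨h, hh, k, hk, e', rfl⟩, e, rfl⟩
      rw [r_mul _ _ e'] at e
      exact ⟨g * h, ⟨g, hg, h, hh, e, rfl⟩, k, hk, by rw [s_mul _ _ e, e'], assoc _ _ _ e e'⟩
  one_mul U := by
    ext γ
    simp only [carrier_mul, carrier_one]
    constructor
    · rintro ⟨x, hx, g, hg, e, rfl⟩
      have : x = (r g : G) := by rw [← e]; exact (congrArg Subtype.val (s_unit ⟨x, hx⟩)).symm
      rwa [this, unit_mul]
    · intro h
      exact ⟨r γ, (r γ).2, γ, h, s_unit _, unit_mul γ⟩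
  mul_one U := by
    ext γ
    simp only [carrier_mul, carrier_one]
    constructor
    · rintro ⟨g, hg, x, hx, e, rfl⟩
      have : x = (s g : G) := by rw [e]; exact (congrArg Subtype.val (r_unit ⟨x, hx⟩)).symm
      rwa [this, mul_unit]
    · intro h
      exact ⟨γ, h, s γ, (s γ).2, (r_unit _).symm, mul_unit γ⟩
  inv_mul_cancel U := by
    ext γ
    simp only [carrier_mul, carrier_one, carrier_inv]
    constructor
    · rintro ⟨g, hg, h, hh, e, rfl⟩
      have h1 : g⁻¹ = h := U.isBisection.1 hg hh (by rw [r_inv, e])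
      rw [← h1, mul_inv_eq]
      exact (r g).2
    · intro h
      obtain ⟨g, hg, e⟩ := U.exists_s ⟨γ, h⟩
      refine ⟨g⁻¹, by rwa [setInv, mem_ofPred_eq, inv_inv_arrow], g, hg, s_inv g, ?_⟩
      rw [inv_mul_eq, e]

end TopologicalFullGroup

end fullgroup

section cstar

variable (G : Type u) [TopologicalSpace G] [TopologicalGroupoid G] [AmpleGroupoid G]
  [CompactSpace (UnitSpace G)]

/-- A nondegenerate representation of the `*`-algebra `C_c(G)` by bounded operators on a nonzero
Hilbert space. As `C_c(G)` has the unit `1_{G⁽⁰⁾}`, nondegenerate means unital. -/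
structure GroupoidRep : Type (u + 1) where
  space : Type u
  [normedAddCommGroup : NormedAddCommGroup space]
  [innerProductSpace : InnerProductSpace ℂ space]
  [completeSpace : CompleteSpace space]
  [nontrivial : Nontrivial space]
  toLinearMap : C_c(G, ℂ) →ₗ[ℂ] (space →L[ℂ] space)
  map_conv : ∀ f g, toLinearMap (conv f g) = toLinearMap f * toLinearMap g
  map_invol : ∀ f, toLinearMap (invol f) = star (toLinearMap f)
  map_unit : toLinearMap (unitFun G) = 1

namespace GroupoidRep

attribute [instance] normedAddCommGroup innerProductSpace completeSpace nontrivial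

variable {G}

/-- The algebra of bounded operators on the space of a representation. -/
abbrev Op (ρ : GroupoidRep G) : Type u := ρ.space →L[ℂ] ρ.space

noncomputable instance (ρ : GroupoidRep G) : CStarAlgebra ρ.Op where

end GroupoidRep

namespace AmpleGroupoid

variable {G}

/-- Extension by zero, `C(G⁽⁰⁾) → C_c(G)`. -/
noncomputable def ofUnits (k : C(UnitSpace G, ℂ)) : C_c(G, ℂ) :=
  cutoff units isOpen_units isCompact_units (k.comp ⟨r, continuous_r⟩)

theorem ofUnits_apply (k : C(UnitSpace G, ℂ)) (γ : G) :
    ofUnits k γ = (units : Set G).indicator (fun γ => k (r γ)) γ := rfl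

theorem conv_ofUnits (h k : C(UnitSpace G, ℂ)) :
    conv (ofUnits h) (ofUnits k) = ofUnits (h * k) := by
  refine CompactlySupportedContinuousMap.ext fun γ => ?_
  have hz : ∀ x ∉ (units : Set G), ofUnits h x = 0 := fun x hx => indicator_of_notMem hx _
  rw [conv_apply, convFun_of_mem isBisection_units hz _ (r γ).2 (r_unit _), unit_inv, unit_mul]
  simp only [ofUnits_apply]
  rw [indicator_of_mem (r γ).2, r_unit]
  by_cases hγ : γ ∈ (units : Set G)
  · simp [hγ]
  · simp [hγ]

theorem inv_mem_units {γ : G} : γ⁻¹ ∈ (units : Set G) ↔ γ ∈ (units : Set G) := by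
  have key : ∀ γ : G, γ ∈ (units : Set G) → γ⁻¹ ∈ (units : Set G) := fun γ h => by
    rw [unit_inv ⟨γ, h⟩]; exact h
  exact ⟨fun h => inv_inv_arrow γ ▸ key _ h, key γ⟩

theorem invol_ofUnits (k : C(UnitSpace G, ℂ)) : invol (ofUnits k) = ofUnits (star k) := by
  refine CompactlySupportedContinuousMap.ext fun γ => ?_
  rw [invol_apply, ofUnits_apply, ofUnits_apply]
  by_cases hγ : γ ∈ (units : Set G)
  · rw [unit_inv ⟨γ, hγ⟩, indicator_of_mem hγ, indicator_of_mem hγ]; rfl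
  · rw [indicator_of_notMem hγ, indicator_of_notMem (mt inv_mem_units.1 hγ), star_zero]

/-- The restriction of a representation to `C(G⁽⁰⁾)`. -/
noncomputable def restrictUnits (ρ : GroupoidRep G) : C(UnitSpace G, ℂ) →⋆ₙₐ[ℂ] ρ.Op where
  toFun k := ρ.toLinearMap (ofUnits k)
  map_smul' c k := by
    rw [← map_smul]
    refine congrArg _ (CompactlySupportedContinuousMap.ext fun γ => ?_)
    rw [CompactlySupportedContinuousMap.smul_apply, ofUnits_apply, ofUnits_apply]
    by_cases hγ : γ ∈ (units : Set G) <;> simp [hγ]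
  map_zero' := by
    rw [← map_zero ρ.toLinearMap]
    refine congrArg _ (CompactlySupportedContinuousMap.ext fun γ => ?_)
    rw [ofUnits_apply]; simp
  map_add' h k := by
    rw [← map_add]
    refine congrArg _ (CompactlySupportedContinuousMap.ext fun γ => ?_)
    rw [CompactlySupportedContinuousMap.add_apply, ofUnits_apply, ofUnits_apply, ofUnits_apply]
    by_cases hγ : γ ∈ (units : Set G) <;> simp [hγ]
  map_mul' h k := by rw [← ρ.map_conv, conv_ofUnits]
  map_star' k := by rw [← ρ.map_invol, invol_ofUnits]

/-- The norms of `f ∈ C_c(G)` in all representations are bounded by a common constant. -/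
theorem exists_bound (f : C_c(G, ℂ)) : ∃ K : ℝ, ∀ ρ : GroupoidRep G, ‖ρ.toLinearMap f‖ ≤ K := by
  induction f using cc_induction with
  | hz => exact ⟨0, fun ρ => by simp⟩
  | ha f g hf hg =>
    obtain ⟨K, hK⟩ := hf
    obtain ⟨L, hL⟩ := hg
    exact ⟨K + L, fun ρ => by
      rw [map_add]; exact (norm_add_le _ _).trans (add_le_add (hK ρ) (hL ρ))⟩
  | hs U hUo hUc hU f hf =>
    set h := conv (invol f) f with hh
    set k : C(UnitSpace G, ℂ) := ⟨fun x => h (x : G), h.1.continuous.comp continuous_subtype_val⟩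
      with hk
    have hhk : h = ofUnits k := by
      refine CompactlySupportedContinuousMap.ext fun γ => ?_
      rw [ofUnits_apply]
      by_cases hγ : γ ∈ (units : Set G)
      · rw [indicator_of_mem hγ, r_unit ⟨γ, hγ⟩]; rfl
      · rw [indicator_of_notMem hγ]
        refine finsum_eq_zero_of_forall_eq_zero fun p => ?_
        by_contra hne
        have h1 : p.1.1⁻¹ ∈ U := by
          by_contra hn
          refine left_ne_zero_of_mul hne ?_
          rw [invol_apply, hf _ hn, star_zero]
        have h2 : p.1.2 ∈ U := by_contra fun hn => right_ne_zero_of_mul hne (hf _ hn)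
        have h3 : p.1.1⁻¹ = p.1.2 := hU.1 h1 h2 (by rw [r_inv, p.2.1])
        refine hγ ?_
        rw [← p.2.2, ← h3, mul_inv_eq]
        exact (r p.1.1).2
    refine ⟨Real.sqrt ‖k‖, fun ρ => Real.le_sqrt_of_sq_le ?_⟩
    have h4 : ‖ρ.toLinearMap h‖ = ‖ρ.toLinearMap f‖ ^ 2 := by
      rw [hh, ρ.map_conv, ρ.map_invol, CStarRing.norm_star_mul_self, sq]
    rw [← h4, hhk]
    exact NonUnitalStarAlgHom.norm_apply_le (restrictUnits ρ) k

end AmpleGroupoid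

/-- The `ℓ^∞`-product of the operator algebras of all representations of `C_c(G)`. -/
abbrev RepProduct : Type (u + 1) := lp (fun ρ : GroupoidRep G => ρ.Op) ∞

noncomputable instance : CStarAlgebra (RepProduct G) where

/-- The universal representation `f ↦ (ρ(f))_ρ` of `C_c(G)`. The norm of the image of `f` is
`sup_ρ ‖ρ(f)‖`. -/
noncomputable def universalRep : C_c(G, ℂ) →ₗ[ℂ] RepProduct G where
  toFun f := ⟨fun ρ => ρ.toLinearMap f, memℓp_infty (by
    obtain ⟨K, hK⟩ := exists_bound f
    exact ⟨K, by rintro _ ⟨ρ, rfl⟩; exact hK ρ⟩)⟩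
  map_add' f g := by
    ext1; funext ρ; exact map_add ρ.toLinearMap f g
  map_smul' c f := by
    ext1; funext ρ; exact map_smul ρ.toLinearMap c f

theorem universalRep_conv (f g : C_c(G, ℂ)) :
    universalRep G (conv f g) = universalRep G f * universalRep G g := by
  ext1; funext ρ; exact ρ.map_conv f g

theorem universalRep_invol (f : C_c(G, ℂ)) :
    universalRep G (invol f) = star (universalRep G f) := by
  ext1; funext ρ; exact ρ.map_invol f

theorem universalRep_unit : universalRep G (unitFun G) = 1 := by
  ext1; funext ρ; exact ρ.map_unit

/-- The image of `C_c(G)` in its universal representation. -/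
noncomputable def universalImage : StarSubalgebra ℂ (RepProduct G) where
  carrier := Set.range (universalRep G)
  mul_mem' := by
    rintro _ _ ⟨f, rfl⟩ ⟨g, rfl⟩; exact ⟨conv f g, universalRep_conv G f g⟩
  add_mem' := by
    rintro _ _ ⟨f, rfl⟩ ⟨g, rfl⟩; exact ⟨f + g, map_add _ f g⟩
  algebraMap_mem' c := ⟨c • unitFun G, by
    rw [map_smul, universalRep_unit, Algebra.algebraMap_eq_smul_one]⟩
  star_mem' := by
    rintro _ ⟨f, rfl⟩; exact ⟨invol f, universalRep_invol G f⟩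

/-- The full groupoid C*-algebra `C*(G)`: the completion of `C_c(G)` in the norm
`f ↦ sup_ρ ‖ρ(f)‖`, realized as the closure of `C_c(G)` in its universal representation. -/
abbrev FullCStarAlgebra : Type (u + 1) := ↥(universalImage G).topologicalClosure

noncomputable instance : CStarAlgebra (FullCStarAlgebra G) :=
  StarSubalgebra.cstarAlgebra (universalImage G).topologicalClosure
    (h_closed := (universalImage G).isClosed_topologicalClosure)

/-- The canonical map `C_c(G) → C*(G)`. -/
noncomputable def toFull (f : C_c(G, ℂ)) : FullCStarAlgebra G :=
  ⟨universalRep G f, (universalImage G).le_topologicalClosure ⟨f, rfl⟩⟩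

variable {G}

theorem toFull_conv (f g : C_c(G, ℂ)) : toFull G (conv f g) = toFull G f * toFull G g :=
  Subtype.ext (universalRep_conv G f g)

theorem toFull_invol (f : C_c(G, ℂ)) : toFull G (invol f) = star (toFull G f) :=
  Subtype.ext (universalRep_invol G f)

theorem toFull_unit : toFull G (unitFun G) = 1 := Subtype.ext (universalRep_unit G)

/-- The function `1_U`, for `U ∈ [[G]]`. -/
noncomputable def TopologicalFullGroup.ind (U : TopologicalFullGroup G) : C_c(G, ℂ) :=
  AmpleGroupoid.ind U.carrier U.isOpen U.isCompact

theorem TopologicalFullGroup.ind_mul (U V : TopologicalFullGroup G) :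
    (U * V).ind = conv U.ind V.ind :=
  (conv_ind U.isBisection U.isOpen U.isCompact V.isOpen V.isCompact).symm

theorem TopologicalFullGroup.ind_one : (1 : TopologicalFullGroup G).ind = unitFun G := rfl

theorem TopologicalFullGroup.ind_inv (U : TopologicalFullGroup G) : U⁻¹.ind = invol U.ind := by
  refine CompactlySupportedContinuousMap.ext fun γ => ?_
  rw [invol_apply]
  change (setInv U.carrier).indicator (1 : G → ℂ) γ = star (U.carrier.indicator (1 : G → ℂ) γ⁻¹)
  by_cases h : γ⁻¹ ∈ U.carrier
  · rw [indicator_of_mem h, indicator_of_mem (show γ ∈ setInv U.carrier from h)]; simp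
  · rw [indicator_of_notMem h, indicator_of_notMem (show γ ∉ setInv U.carrier from h)]; simp

variable (G)

/-- The canonical unitary representation `π : [[G]] → C*(G)`, `π(U) = 1_U`. -/
noncomputable def fullGroupRep : TopologicalFullGroup G →* unitary (FullCStarAlgebra G) where
  toFun U := ⟨toFull G U.ind, by
    rw [Unitary.mem_iff, ← toFull_invol, ← TopologicalFullGroup.ind_inv, ← toFull_conv,
      ← toFull_conv, ← TopologicalFullGroup.ind_mul, ← TopologicalFullGroup.ind_mul,
      inv_mul_cancel, mul_inv_cancel, TopologicalFullGroup.ind_one, toFull_unit]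
    exact ⟨rfl, rfl⟩⟩
  map_one' := Subtype.ext (by
    change toFull G (1 : TopologicalFullGroup G).ind = 1
    rw [TopologicalFullGroup.ind_one, toFull_unit])
  map_mul' U V := Subtype.ext (by
    change toFull G (U * V).ind = toFull G U.ind * toFull G V.ind
    rw [TopologicalFullGroup.ind_mul, toFull_conv])

end cstar

section representations

variable {Γ : Type u} [Group Γ] {A : Type v} [CStarAlgebra A] {B : Type w} [CStarAlgebra B]

/-- A unitary representation `σ` of `Γ` in a unital C*-algebra weakly contains another one `η` if
`‖∑ aᵢ η(gᵢ)‖ ≤ ‖∑ aᵢ σ(gᵢ)‖` for all `∑ aᵢ gᵢ ∈ ℂΓ`. -/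
def WeaklyContains (σ : Γ →* unitary A) (η : Γ →* unitary B) : Prop :=
  ∀ a : Γ →₀ ℂ, ‖a.sum fun g c => c • (η g : B)‖ ≤ ‖a.sum fun g c => c • (σ g : A)‖

/-- The trivial representation `g ↦ 1 ∈ ℂ`. -/
def trivialRep (Γ : Type u) [Group Γ] : Γ →* unitary ℂ := 1

/-- The C*-algebra `C*_σ(Γ)` generated by the image of a unitary representation. -/
noncomputable def generatedCStar (σ : Γ →* unitary A) : StarSubalgebra ℂ A :=
  (StarAlgebra.adjoin ℂ (Set.range fun g : Γ => (σ g : A))).topologicalClosure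

end representations

section measures

variable {G : Type u} [TopologicalSpace G] [TopologicalGroupoid G]

/-- The unit space carries its Borel σ-algebra. -/
instance : MeasurableSpace (UnitSpace G) := borel (UnitSpace G)

instance : BorelSpace (UnitSpace G) := ⟨rfl⟩

/-- `μ` is `G`-invariant if `μ(r(S)) = μ(s(S))` for each open bisection `S`. -/
def IsGroupoidInvariant (μ : Measure (UnitSpace G)) : Prop :=
  ∀ S : Set G, IsOpen S → IsBisection S →
    μ ((r : G → UnitSpace G) '' S) = μ ((s : G → UnitSpace G) '' S)

/-- `μ` is `[[G]]`-invariant if it is preserved by `θ_U` for each `U ∈ [[G]]`. -/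
def IsFullGroupInvariant (μ : Measure (UnitSpace G)) : Prop :=
  ∀ U : TopologicalFullGroup G, MeasurePreserving U.theta μ μ

end measures

/-! ### From full-group invariance to groupoid invariance -/

section invariance

variable {G : Type u} [TopologicalSpace G] [TopologicalGroupoid G]

/-! The implications form the cycle (i) → (ii) → (iii) → (iv) → (i).

A `G`-invariant `μ` makes `(T_f ξ)(x) = ∑_{r(α) = x} f(α) ξ(s(α))` a `*`-representation of `C_c(G)`
on `L²(μ)` (`IsGroupoidInvariant.inner_koopman`, `IsGroupoidInvariant.exists_norm_koopman_le`).
Every `1_U` with `U ∈ [[G]]` fixes the constant function `1`, so `∑ αᵢ` is an eigenvalue of the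
image of `∑ αᵢ 1_{Uᵢ}` and is bounded by its norm. Weak containment says that `∑ αᵢ π(Uᵢ) ↦ ∑ αᵢ` is
well defined and contractive on a dense subalgebra; its continuous extension is a character
(`WeaklyContains.nonempty_characterSpace`).

A character extends by Hahn–Banach to a state `φ` of `C*(G)` with `|φ(1_U)| = 1`. Cauchy–Schwarz
then gives `φ(y 1_U) = φ(y) φ(1_U)` and `φ(1_U y) = φ(1_U) φ(y)`, so the covariance relation `1_U ⋆
(k ∘ θ_U) = k ⋆ 1_U` yields `φ(k ∘ θ_U) = φ(k)`. The Riesz measure of `φ` on `C(G⁽⁰⁾)` is therefore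
`[[G]]`-invariant.

Finally, split an open bisection into the arrows with `r = s`, where there is nothing to prove, and
the rest. The rest is locally made of compact open bisections `V` with `r(V)` and `s(V)` disjoint,
and such a `V` extends to the element `swapElement` of `[[G]]`, which exchanges the two sets. Inner
regularity passes from compact pieces to the whole (`IsFullGroupInvariant.isGroupoidInvariant`). -/

theorem IsBisection.mono {S T : Set G} (hT : IsBisection T) (h : S ⊆ T) : IsBisection S :=
  ⟨hT.1.mono h, hT.2.mono h⟩

theorem image_r_setInv (S : Set G) :
    (r : G → UnitSpace G) '' setInv S = (s : G → UnitSpace G) '' S := by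
  ext x
  constructor
  · rintro ⟨g, hg, rfl⟩
    exact ⟨g⁻¹, hg, s_inv g⟩
  · rintro ⟨g, hg, rfl⟩
    exact ⟨g⁻¹, by rwa [setInv, mem_ofPred_eq, inv_inv_arrow], r_inv g⟩

theorem image_s_setInv (S : Set G) :
    (s : G → UnitSpace G) '' setInv S = (r : G → UnitSpace G) '' S := by
  ext x
  constructor
  · rintro ⟨g, hg, rfl⟩
    exact ⟨g⁻¹, hg, r_inv g⟩
  · rintro ⟨g, hg, rfl⟩
    exact ⟨g⁻¹, by rwa [setInv, mem_ofPred_eq, inv_inv_arrow], s_inv g⟩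

theorem IsBisection.setInv {S : Set G} (hS : IsBisection S) : IsBisection (setInv S) := by
  constructor
  · intro g hg h hh e
    have := hS.2 hg hh (by rw [s_inv, s_inv, e])
    rw [← inv_inv_arrow g, this, inv_inv_arrow]
  · intro g hg h hh e
    have := hS.1 hg hh (by rw [r_inv, r_inv, e])
    rw [← inv_inv_arrow g, this, inv_inv_arrow]

theorem isOpen_setInv {S : Set G} (hS : IsOpen S) : IsOpen (setInv S) :=
  hS.preimage continuous_inversion

variable [AmpleGroupoid G]

theorem isOpenMap_r : IsOpenMap (r : G → UnitSpace G) := isLocalHomeomorph_r.isOpenMap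

theorem isOpenMap_s : IsOpenMap (s : G → UnitSpace G) := isLocalHomeomorph_s.isOpenMap

variable [CompactSpace (UnitSpace G)]

theorem isCompact_setInv {S : Set G} (hS : IsCompact S) : IsCompact (setInv S) :=
  (invHomeo (G := G)).isCompact_preimage.2 hS

/-- The element of `[[G]]` that exchanges the disjoint sets `r(V)` and `s(V)` by means of `V` and
fixes the other units. -/
noncomputable def swapElement (V : Set G) (hVo : IsOpen V) (hVc : IsCompact V)
    (hV : IsBisection V) (hd : Disjoint ((r : G → UnitSpace G) '' V) ((s : G → UnitSpace G) '' V)) :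
    TopologicalFullGroup G where
  carrier := V ∪ setInv V ∪
    Subtype.val '' ((r : G → UnitSpace G) '' V ∪ (s : G → UnitSpace G) '' V)ᶜ
  isOpen := by
    have hc : IsClosed ((r : G → UnitSpace G) '' V ∪ (s : G → UnitSpace G) '' V) :=
      (hVc.image continuous_r).isClosed.union (hVc.image continuous_s).isClosed
    exact (hVo.union (isOpen_setInv hVo)).union
      (isOpen_units.isOpenMap_subtype_val _ hc.isOpen_compl)
  isCompact := by
    have ho : IsOpen ((r : G → UnitSpace G) '' V ∪ (s : G → UnitSpace G) '' V) :=
      (isOpenMap_r _ hVo).union (isOpenMap_s _ hVo)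
    exact (hVc.union (isCompact_setInv hVc)).union
      (ho.isClosed_compl.isCompact.image continuous_subtype_val)
  isBisection := by
    have hd' : ∀ g ∈ V, ∀ h ∈ V, r g ≠ s h := fun g hg h hh e =>
      disjoint_left.1 hd ⟨g, hg, rfl⟩ ⟨h, hh, e.symm⟩
    constructor
    · rintro g ((hg | hg) | ⟨x, hx, rfl⟩) h ((hh | hh) | ⟨y, hy, rfl⟩) e
      · exact hV.1 hg hh e
      · exact (hd' g hg _ hh (by rw [s_inv, e])).elim
      · rw [r_unit] at e
        exact (hy (Or.inl ⟨g, hg, e⟩)).elim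
      · exact (hd' h hh _ hg (by rw [s_inv, e])).elim
      · exact hV.setInv.1 hg hh e
      · rw [r_unit] at e
        exact (hy (Or.inr ⟨_, hg, by rw [s_inv, e]⟩)).elim
      · rw [r_unit] at e
        exact (hx (Or.inl ⟨h, hh, e.symm⟩)).elim
      · rw [r_unit] at e
        exact (hx (Or.inr ⟨_, hh, by rw [s_inv, e]⟩)).elim
      · rw [r_unit, r_unit] at e
        rw [e]
    · rintro g ((hg | hg) | ⟨x, hx, rfl⟩) h ((hh | hh) | ⟨y, hy, rfl⟩) e
      · exact hV.2 hg hh e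
      · exact (hd' _ hh g hg (by rw [r_inv, e])).elim
      · rw [s_unit] at e
        exact (hy (Or.inr ⟨g, hg, e⟩)).elim
      · exact (hd' _ hg h hh (by rw [r_inv, e])).elim
      · exact hV.setInv.2 hg hh e
      · rw [s_unit] at e
        exact (hy (Or.inl ⟨_, hg, by rw [r_inv, e]⟩)).elim
      · rw [s_unit] at e
        exact (hx (Or.inr ⟨h, hh, e.symm⟩)).elim
      · rw [s_unit] at e
        exact (hx (Or.inl ⟨_, hh, by rw [r_inv, e]⟩)).elim
      · rw [s_unit, s_unit] at e
        rw [e]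
  r_image := by
    rw [image_union, image_union, image_r_setInv, image_image]
    simp only [r_unit, image_id']
    exact union_compl_self _
  s_image := by
    rw [image_union, image_union, image_s_setInv, image_image, union_comm (s '' V)]
    simp only [s_unit, image_id']
    exact union_compl_self _

theorem swapElement_preimage (V : Set G) (hVo : IsOpen V) (hVc : IsCompact V)
    (hV : IsBisection V) (hd : Disjoint ((r : G → UnitSpace G) '' V) ((s : G → UnitSpace G) '' V)) :
    (swapElement V hVo hVc hV hd).theta ⁻¹' (r '' V) = s '' V := by
  set U := swapElement V hVo hVc hV hd with hU
  ext x
  constructor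
  · intro hx
    obtain ⟨g, hg, rfl⟩ := U.exists_s x
    rw [mem_preimage, U.theta_s hg] at hx
    rcases hg with (hg | hg) | ⟨y, hy, rfl⟩
    · exact ⟨g, hg, rfl⟩
    · exact (disjoint_left.1 hd hx ⟨_, hg, s_inv g⟩).elim
    · rw [r_unit] at hx
      exact (hy (Or.inl hx)).elim
  · rintro ⟨g, hg, rfl⟩
    rw [mem_preimage, U.theta_s (Or.inl (Or.inl hg))]
    exact ⟨g, hg, rfl⟩

theorem IsFullGroupInvariant.measure_swap {μ : Measure (UnitSpace G)}
    (hμ : IsFullGroupInvariant μ) {V : Set G} (hVo : IsOpen V) (hVc : IsCompact V)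
    (hV : IsBisection V) (hd : Disjoint ((r : G → UnitSpace G) '' V) ((s : G → UnitSpace G) '' V)) :
    μ ((r : G → UnitSpace G) '' V) = μ ((s : G → UnitSpace G) '' V) := by
  rw [← swapElement_preimage V hVo hVc hV hd]
  exact ((hμ _).measure_preimage (isOpenMap_r _ hVo).measurableSet.nullMeasurableSet).symm

/-- An arrow with distinct range and source has a compact open bisection as a neighbourhood whose
range and source are disjoint. -/
theorem exists_bisection_disjoint {g : G} {W : Set G} (hW : IsOpen W) (hg : g ∈ W)
    (hrs : (r g : UnitSpace G) ≠ s g) :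
    ∃ U : Set G, IsOpen U ∧ IsCompact U ∧ IsBisection U ∧ g ∈ U ∧ U ⊆ W ∧
      Disjoint ((r : G → UnitSpace G) '' U) ((s : G → UnitSpace G) '' U) := by
  obtain ⟨A, B, hA, hB, hrA, hsB, hAB⟩ := t2_separation hrs
  obtain ⟨U, hUo, hUc, hU, hgU, hUW⟩ := exists_bisection
    ((hW.inter (hA.preimage continuous_r)).inter (hB.preimage continuous_s)) ⟨⟨hg, hrA⟩, hsB⟩
  refine ⟨U, hUo, hUc, hU, hgU, fun x hx => (hUW hx).1.1, hAB.mono ?_ ?_⟩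
  · rintro _ ⟨x, hx, rfl⟩
    exact (hUW hx).1.2
  · rintro _ ⟨x, hx, rfl⟩
    exact (hUW hx).2

/-- Injectivity of `r` and `s` on `S` keeps the images disjoint. Openness of one piece suffices for
additivity; the other will be the set of arrows with `r = s`, which need not be open. -/
theorem measure_image_union {μ : Measure (UnitSpace G)} {S A B : Set G} (hS : IsBisection S)
    (hA : A ⊆ S) (hB : B ⊆ S) (hd : Disjoint A B) (hBo : IsOpen B) :
    μ ((r : G → UnitSpace G) '' (A ∪ B)) = μ (r '' A) + μ (r '' B) ∧
      μ ((s : G → UnitSpace G) '' (A ∪ B)) = μ (s '' A) + μ (s '' B) := by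
  constructor
  · rw [image_union]
    exact measure_union (hd.image hS.1 hA hB)
      (isOpenMap_r _ hBo).measurableSet
  · rw [image_union]
    exact measure_union (hd.image hS.2 hA hB)
      (isOpenMap_s _ hBo).measurableSet

/-- The sets `V i` are clopen, so they can be removed from `C` one at a time: `C ∩ V a` is handled
by a swap, and `C \ V a` is still compact open and is covered by the remaining sets. -/
theorem IsFullGroupInvariant.measure_compact {μ : Measure (UnitSpace G)}
    (hμ : IsFullGroupInvariant μ) {S : Set G} (hS : IsBisection S) {ι : Type*} (t : Finset ι)
    (V : ι → Set G) (hVo : ∀ i, IsOpen (V i)) (hVc : ∀ i, IsCompact (V i))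
    (hd : ∀ i, Disjoint ((r : G → UnitSpace G) '' V i) ((s : G → UnitSpace G) '' V i))
    {C : Set G} (hCo : IsOpen C) (hCc : IsCompact C) (hCS : C ⊆ S) (hCV : C ⊆ ⋃ i ∈ t, V i) :
    μ ((r : G → UnitSpace G) '' C) = μ ((s : G → UnitSpace G) '' C) := by
  classical
  induction t using Finset.induction_on generalizing C with
  | empty =>
    have : C = ∅ := by simpa using hCV
    simp [this]
  | insert a t _ ih =>
    have h1 := measure_image_union (μ := μ) hS (A := C \ V a) (B := C ∩ V a)
      (sdiff_subset.trans hCS) (inter_subset_left.trans hCS)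
      (disjoint_sdiff_inter) (hCo.inter (hVo a))
    rw [sdiff_union_inter] at h1
    rw [h1.1, h1.2]
    congr 1
    · refine ih (hCo.sdiff (hVc a).isClosed) (hCc.diff (hVo a)) (sdiff_subset.trans hCS) ?_
      rintro x ⟨hx, hxa⟩
      have := hCV hx
      rw [Finset.set_biUnion_insert] at this
      exact this.resolve_left hxa
    · exact hμ.measure_swap (hCo.inter (hVo a)) (hCc.inter (hVc a))
        (hS.mono (inter_subset_left.trans hCS))
        ((hd a).mono (image_mono inter_subset_right) (image_mono inter_subset_right))

/-- Inner regularity of the open set `r(S)` reduces the bound to compact `K ⊆ r(S)`, which is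
covered by the ranges of finitely many bisections inside `S` with disjoint range and source. -/
theorem IsFullGroupInvariant.measure_le_of_free {μ : Measure (UnitSpace G)} [μ.Regular]
    (hμ : IsFullGroupInvariant μ) {S : Set G} (hSo : IsOpen S) (hS : IsBisection S)
    (hfree : ∀ g ∈ S, (r g : UnitSpace G) ≠ s g) :
    μ ((r : G → UnitSpace G) '' S) ≤ μ ((s : G → UnitSpace G) '' S) := by
  rw [(isOpenMap_r _ hSo).measure_eq_iSup_isCompact]
  refine iSup₂_le fun K hK => iSup_le fun hKc => ?_
  choose V hVo hVc _ hgV hVS hVd using fun g : S =>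
    exists_bisection_disjoint hSo g.2 (hfree g g.2)
  obtain ⟨t, ht⟩ := hKc.elim_finite_subcover (fun g => (r : G → UnitSpace G) '' V g)
    (fun g => isOpenMap_r _ (hVo g)) (fun x hx => by
      obtain ⟨g, hg, rfl⟩ := hK hx
      exact mem_iUnion.2 ⟨⟨g, hg⟩, _, hgV ⟨g, hg⟩, rfl⟩)
  have hCS : (⋃ i ∈ t, V i) ⊆ S := iUnion₂_subset fun i _ => hVS i
  calc μ K ≤ μ (r '' ⋃ i ∈ t, V i) := measure_mono (by simpa only [image_iUnion] using ht)
    _ = μ (s '' ⋃ i ∈ t, V i) := hμ.measure_compact hS t V hVo hVc hVd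
        (isOpen_biUnion fun i _ => hVo i) (t.isCompact_biUnion fun i _ => hVc i) hCS subset_rfl
    _ ≤ μ (s '' S) := measure_mono (image_mono hCS)

theorem IsFullGroupInvariant.isGroupoidInvariant {μ : Measure (UnitSpace G)} [μ.Regular]
    (hμ : IsFullGroupInvariant μ) : IsGroupoidInvariant μ := by
  intro S hSo hS
  set F : Set G := {g ∈ S | (r g : UnitSpace G) = s g} with hF
  set N : Set G := {g ∈ S | (r g : UnitSpace G) ≠ s g} with hN
  have hNo : IsOpen N := hSo.inter (isClosed_eq continuous_r continuous_s).isOpen_compl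
  have hNb : IsBisection N := hS.mono fun g hg => hg.1
  have hunion : F ∪ N = S := by
    ext g
    simp only [hF, hN, mem_union, mem_ofPred_eq]
    tauto
  have h1 := measure_image_union (μ := μ) hS (A := F) (B := N) (fun g hg => hg.1)
    (fun g hg => hg.1) (disjoint_left.2 fun g hg hg' => hg'.2 hg.2) hNo
  have h2 : (r : G → UnitSpace G) '' F = s '' F := image_congr fun g hg => hg.2
  rw [hunion] at h1
  rw [h1.1, h1.2, h2]
  congr 1
  refine le_antisymm (hμ.measure_le_of_free hNo hNb fun g hg => hg.2) ?_
  -- Inversion exchanges `r` and `s`, so the same inequality for the inverse bisection is the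
  -- reverse one.
  have := hμ.measure_le_of_free (isOpen_setInv hNo) hNb.setInv fun g hg h =>
    hg.2 (by rw [r_inv, s_inv, h])
  rwa [image_r_setInv, image_s_setInv] at this

theorem TopologicalFullGroup.preimage_theta (U : TopologicalFullGroup G)
    (A : Set (UnitSpace G)) : U.theta ⁻¹' A = s '' (U.carrier ∩ r ⁻¹' A) := by
  ext x
  constructor
  · intro hx
    obtain ⟨g, hg, rfl⟩ := U.exists_s x
    rw [mem_preimage, U.theta_s hg] at hx
    exact ⟨g, ⟨hg, hx⟩, rfl⟩
  · rintro ⟨g, ⟨hg, hr⟩, rfl⟩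
    rwa [mem_preimage, U.theta_s hg]

theorem TopologicalFullGroup.continuous_theta (U : TopologicalFullGroup G) :
    Continuous U.theta := by
  refine continuous_def.2 fun A hA => ?_
  rw [U.preimage_theta]
  exact isOpenMap_s _ (U.isOpen.inter (hA.preimage continuous_r))

theorem Measure.ext_of_forall_isOpen {X : Type*} [TopologicalSpace X] [MeasurableSpace X]
    [BorelSpace X] {μ ν : Measure X} [IsFiniteMeasure μ]
    (h : ∀ A, IsOpen A → μ A = ν A) : μ = ν :=
  ext_of_generate_finite {A | IsOpen A} (BorelSpace.measurable_eq (α := X))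
    isPiSystem_isOpen (fun A hA => h A hA) (h _ isOpen_univ)

end invariance

/-! ### The representation on `L²(μ)` of an invariant measure -/

section koopman

variable {G : Type u} [TopologicalSpace G] [TopologicalGroupoid G] [AmpleGroupoid G]
  [CompactSpace (UnitSpace G)]

/-- Here and below the right factor is an arbitrary function, because it will be `ξ ∘ r`, which need
not have compact support. -/
theorem convFun_smul_left (c : ℂ) (f : C_c(G, ℂ)) (k : G → ℂ) :
    convFun (c • f : C_c(G, ℂ)) k = c • convFun f k := by
  funext γ
  rw [Pi.smul_apply, convFun, convFun, smul_finsum]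
  exact finsum_congr fun p => by
    rw [CompactlySupportedContinuousMap.smul_apply, smul_eq_mul, smul_eq_mul, mul_assoc]

theorem convFun_zero_left (k : G → ℂ) : convFun (0 : C_c(G, ℂ)) k = 0 := by
  funext γ
  simp [convFun]

theorem convFun_add_right (f : C_c(G, ℂ)) (k l : G → ℂ) :
    convFun f (k + l) = convFun f k + convFun f l := by
  funext γ
  have h : ∀ g : G → ℂ, (Function.support fun p : Factor γ => f p.1.1 * g p.1.2).Finite :=
    fun g => (factor_finite f γ).subset fun p hp => left_ne_zero_of_mul hp
  rw [Pi.add_apply, convFun, convFun, convFun, ← finsum_add_distrib (h k) (h l)]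
  exact finsum_congr fun p => by rw [Pi.add_apply, mul_add]

theorem convFun_smul_right (c : ℂ) (f : C_c(G, ℂ)) (k : G → ℂ) :
    convFun f (c • k) = c • convFun f k := by
  funext γ
  rw [Pi.smul_apply, convFun, convFun, smul_finsum]
  exact finsum_congr fun p => by
    rw [Pi.smul_apply, smul_eq_mul, smul_eq_mul, mul_left_comm]

theorem conv_add_left (f₁ f₂ h : C_c(G, ℂ)) : conv (f₁ + f₂) h = conv f₁ h + conv f₂ h :=
  CompactlySupportedContinuousMap.ext fun γ => congrFun (convFun_add f₁ f₂ h) γ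

theorem conv_zero_left (h : C_c(G, ℂ)) : conv 0 h = 0 :=
  CompactlySupportedContinuousMap.ext fun γ => congrFun (convFun_zero_left h) γ

theorem convFun_of_forall_ne {f : G → ℂ} {U : Set G} (hf : ∀ x ∉ U, f x = 0) (k : G → ℂ) {γ : G}
    (h : ¬ ∃ α ∈ U, r α = r γ) : convFun f k γ = 0 :=
  convFun_of_notMem hf k fun α hα e => h ⟨α, hα, e⟩

/-- Left translation of factorizations. -/
def factorTranslate {α γ : G} (h : r α = r γ) : Factor γ ≃ Factor (α⁻¹ * γ) where
  toFun p := ⟨(α⁻¹ * p.1.1, p.1.2), by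
    have e : s α⁻¹ = r p.1.1 := by rw [s_inv, h, factor_r]
    rw [s_mul _ _ e]
    exact ⟨p.2.1, by rw [assoc _ _ _ e p.2.1, p.2.2]⟩⟩
  invFun q := ⟨(α * q.1.1, q.1.2), by
    have e : s α = r q.1.1 := by
      rw [factor_r, r_mul _ _ ((s_inv α).trans h), r_inv]
    rw [s_mul _ _ e]
    exact ⟨q.2.1, by rw [assoc _ _ _ e q.2.1, q.2.2, inv_mul_cancel_left h]⟩⟩
  left_inv p := factor_ext _ _ (inv_mul_cancel_left (h.trans (factor_r p).symm))
  right_inv q := factor_ext _ _ (mul_inv_cancel_left (by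
    rw [factor_r, r_mul _ _ ((s_inv α).trans h), r_inv]))

/-- By linearity `f` may live on a bisection. Convolution by `f` is then a weighted translation by a
single arrow, and `factorTranslate` reindexes the remaining sum, so no double sum appears. -/
theorem convFun_assoc (f h : C_c(G, ℂ)) (k : G → ℂ) :
    convFun (conv f h) k = convFun f (convFun h k) := by
  induction f using cc_induction with
  | hz => rw [conv_zero_left, convFun_zero_left, convFun_zero_left]
  | ha f₁ f₂ h₁ h₂ => rw [conv_add_left, convFun_add, convFun_add, h₁, h₂]
  | hs U hUo hUc hU f hf =>
    funext γ
    by_cases hγ : ∃ α ∈ U, r α = r γ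
    · obtain ⟨α, hα, hr⟩ := hγ
      rw [convFun_of_mem hU hf _ hα hr, convFun, convFun, ← smul_eq_mul, smul_finsum,
        ← finsum_comp_equiv (factorTranslate hr)]
      refine finsum_congr fun p => ?_
      rw [conv_apply, convFun_of_mem hU hf _ hα (hr.trans (factor_r p).symm), smul_eq_mul,
        mul_assoc]
      rfl
    · rw [convFun_of_forall_ne hf _ hγ, convFun]
      refine finsum_eq_zero_of_forall_eq_zero fun p => ?_
      rw [conv_apply, convFun_of_forall_ne hf _ (by rwa [factor_r]), zero_mul]

/-- Since `r(α⁻¹γ) = s(α)`, the sum only involves arrows `α` with range `r(γ)`. Hence functions of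
the form `ξ ∘ r` are stable under convolution from the left, which is what makes `koopman`
multiplicative. -/
theorem convFun_comp_r (f : C_c(G, ℂ)) (ξ : UnitSpace G → ℂ) (γ : G) :
    convFun f (ξ ∘ r) γ = convFun f (ξ ∘ r) (r γ : G) := by
  induction f using cc_induction with
  | hz => rw [convFun_zero_left]; rfl
  | ha f₁ f₂ h₁ h₂ => rw [convFun_add, Pi.add_apply, Pi.add_apply, h₁, h₂]
  | hs U hUo hUc hU f hf =>
    by_cases hγ : ∃ α ∈ U, r α = r γ
    · obtain ⟨α, hα, hr⟩ := hγ
      have hr' : r α = r (r γ : G) := by rw [hr, r_unit]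
      rw [convFun_of_mem hU hf _ hα hr, convFun_of_mem hU hf _ hα hr', Function.comp_apply,
        Function.comp_apply, r_mul _ _ ((s_inv α).trans hr), r_mul _ _ ((s_inv α).trans hr')]
    · rw [convFun_of_forall_ne hf _ hγ, convFun_of_forall_ne hf _ (by rwa [r_unit])]

theorem continuous_convFun_comp_r (f : C_c(G, ℂ)) (ξ : C(UnitSpace G, ℂ)) :
    Continuous fun x : UnitSpace G => convFun f (ξ ∘ r) x := by
  induction f using cc_induction with
  | hz => simp only [convFun_zero_left]; exact continuous_const
  | ha f₁ f₂ h₁ h₂ => simp only [convFun_add]; exact h₁.add h₂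
  | hs U hUo hUc hU f hf =>
    -- At a unit the second factor is `α⁻¹` with `α ∈ U`, so cutting `ξ ∘ r` off outside `U⁻¹`
    -- changes nothing there and leaves a convolution inside `C_c(G)`, whose continuity is known.
    have key : (fun x : UnitSpace G => convFun f (ξ ∘ r) x) = fun x : UnitSpace G =>
        conv f (cutoff (setInv U) (isOpen_setInv hUo) (isCompact_setInv hUc)
          (ξ.comp ⟨r, continuous_r⟩)) (x : G) := by
      funext x
      rw [conv_apply]
      by_cases hx : ∃ α ∈ U, r α = r (x : G)
      · obtain ⟨α, hα, hr⟩ := hx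
        rw [convFun_of_mem hU hf _ hα hr, convFun_of_mem hU hf _ hα hr]
        congr 1
        refine (indicator_of_mem ?_ (ξ ∘ r)).symm
        have : α⁻¹ * (x : G) = α⁻¹ := by
          rw [r_unit] at hr
          rw [← hr, ← s_inv, mul_unit]
        rwa [this, setInv, mem_ofPred_eq, inv_inv_arrow]
      · rw [convFun_of_forall_ne hf _ hx, convFun_of_forall_ne hf _ hx]
    rw [key]
    exact (conv f _).1.continuous.comp continuous_subtype_val

/-- The operator `(T_f ξ)(x) = ∑_{r(α) = x} f(α) ξ(s(α))` on `C(G⁽⁰⁾)`. -/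
noncomputable def koopman (f : C_c(G, ℂ)) : C(UnitSpace G, ℂ) →ₗ[ℂ] C(UnitSpace G, ℂ) where
  toFun ξ := ⟨fun x => convFun f (ξ ∘ r) x, continuous_convFun_comp_r f ξ⟩
  map_add' ξ η := ContinuousMap.ext fun x => congrFun (convFun_add_right f (ξ ∘ r) (η ∘ r)) (x : G)
  map_smul' c ξ := ContinuousMap.ext fun x => congrFun (convFun_smul_right c f (ξ ∘ r)) (x : G)

theorem koopman_apply (f : C_c(G, ℂ)) (ξ : C(UnitSpace G, ℂ)) (x : UnitSpace G) :
    koopman f ξ x = convFun f (ξ ∘ r) x := rfl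

theorem koopman_zero : koopman (0 : C_c(G, ℂ)) = 0 :=
  LinearMap.ext fun ξ => ContinuousMap.ext fun x => congrFun (convFun_zero_left (ξ ∘ r)) (x : G)

theorem koopman_add (f h : C_c(G, ℂ)) : koopman (f + h) = koopman f + koopman h :=
  LinearMap.ext fun ξ => ContinuousMap.ext fun x => congrFun (convFun_add f h (ξ ∘ r)) (x : G)

theorem koopman_smul (c : ℂ) (f : C_c(G, ℂ)) : koopman (c • f) = c • koopman f :=
  LinearMap.ext fun ξ => ContinuousMap.ext fun x =>
    congrFun (convFun_smul_left c f (ξ ∘ r)) (x : G)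

theorem koopman_conv (f h : C_c(G, ℂ)) (ξ : C(UnitSpace G, ℂ)) :
    koopman (conv f h) ξ = koopman f (koopman h ξ) := by
  refine ContinuousMap.ext fun x => ?_
  rw [koopman_apply, koopman_apply, convFun_assoc]
  congr 1
  funext γ
  exact convFun_comp_r h ξ γ

theorem koopman_r {f : C_c(G, ℂ)} {U : Set G} (hU : IsBisection U) (hf : ∀ x ∉ U, f x = 0)
    (ξ : C(UnitSpace G, ℂ)) {α : G} (hα : α ∈ U) : koopman f ξ (r α) = f α * ξ (s α) := by
  have hr : r α = r (r α : G) := (r_unit _).symm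
  rw [koopman_apply, convFun_of_mem hU hf _ hα hr, Function.comp_apply,
    r_mul _ _ ((s_inv α).trans hr), r_inv]

theorem koopman_of_notMem {f : C_c(G, ℂ)} {U : Set G} (hf : ∀ x ∉ U, f x = 0)
    (ξ : C(UnitSpace G, ℂ)) {x : UnitSpace G} (hx : x ∉ (r : G → UnitSpace G) '' U) :
    koopman f ξ x = 0 :=
  convFun_of_forall_ne hf _ fun ⟨α, hα, h⟩ => hx ⟨α, hα, by rw [h, r_unit]⟩

theorem invol_eq_zero {f : C_c(G, ℂ)} {U : Set G} (hf : ∀ x ∉ U, f x = 0) :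
    ∀ x ∉ setInv U, invol f x = 0 := fun x hx => by
  rw [invol_apply, hf _ hx, star_zero]

theorem koopman_invol_s {f : C_c(G, ℂ)} {U : Set G} (hU : IsBisection U)
    (hf : ∀ x ∉ U, f x = 0) (ξ : C(UnitSpace G, ℂ)) {α : G} (hα : α ∈ U) :
    koopman (invol f) ξ (s α) = star (f α) * ξ (r α) := by
  have hα' : α⁻¹ ∈ setInv U := by rwa [setInv, mem_ofPred_eq, inv_inv_arrow]
  rw [← r_inv α, koopman_r hU.setInv (invol_eq_zero hf) ξ hα', invol_apply, inv_inv_arrow, s_inv]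

theorem koopman_unitFun (ξ : C(UnitSpace G, ℂ)) : koopman (unitFun G) ξ = ξ := by
  refine ContinuousMap.ext fun x => ?_
  have h := koopman_r (f := unitFun G) isBisection_units
    (fun x hx => indicator_of_notMem hx _) ξ x.2
  rw [r_unit, s_unit] at h
  rw [h, unitFun, ind_apply, indicator_of_mem x.2, Pi.one_apply, one_mul]

/-- Each unit is the range of exactly one arrow of `U`. This provides the invariant vector for
`[[G]]`. -/
theorem koopman_ind (U : TopologicalFullGroup G) : koopman U.ind 1 = 1 := by
  refine ContinuousMap.ext fun x => ?_
  obtain ⟨g, hg, rfl⟩ := U.exists_r x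
  rw [koopman_r U.isBisection (fun x hx => indicator_of_notMem hx _) _ hg,
    ContinuousMap.one_apply, ContinuousMap.one_apply, TopologicalFullGroup.ind, ind_apply,
    indicator_of_mem hg, Pi.one_apply, one_mul]

/-- Both `r` and `s` embed `U` as an open subset of the unit space. Open subsets of `U` are again
open bisections, so invariance says that the two pullbacks of `μ` to `U` coincide; both integrals
are computed on `U`. -/
theorem IsGroupoidInvariant.integral_eq {μ : Measure (UnitSpace G)} [IsFiniteMeasure μ]
    (hμ : IsGroupoidInvariant μ) {U : Set G} (hUo : IsOpen U) (hU : IsBisection U)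
    {φ ψ : UnitSpace G → ℂ} (hφ : ∀ x ∉ (r : G → UnitSpace G) '' U, φ x = 0)
    (hψ : ∀ x ∉ (s : G → UnitSpace G) '' U, ψ x = 0) (h : ∀ g ∈ U, φ (r g) = ψ (s g)) :
    ∫ x, φ x ∂μ = ∫ x, ψ x ∂μ := by
  let : MeasurableSpace U := borel U
  have : BorelSpace U := ⟨rfl⟩
  have hr : IsOpenEmbedding fun u : U => (r (u : G) : UnitSpace G) :=
    .of_continuous_injective_isOpenMap (continuous_r.comp continuous_subtype_val)
      (injOn_iff_injective.1 hU.1) (isOpenMap_r.comp hUo.isOpenMap_subtype_val)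
  have hs : IsOpenEmbedding fun u : U => (s (u : G) : UnitSpace G) :=
    .of_continuous_injective_isOpenMap (continuous_s.comp continuous_subtype_val)
      (injOn_iff_injective.1 hU.2) (isOpenMap_s.comp hUo.isOpenMap_subtype_val)
  have hrm := hr.measurableEmbedding
  have hsm := hs.measurableEmbedding
  have hfin : IsFiniteMeasure (μ.comap fun u : U => (r (u : G) : UnitSpace G)) :=
    ⟨by rw [hrm.comap_apply]; exact measure_lt_top _ _⟩
  have hcomap : μ.comap (fun u : U => (r (u : G) : UnitSpace G)) =
      μ.comap fun u : U => (s (u : G) : UnitSpace G) := by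
    refine Measure.ext_of_forall_isOpen fun A hA => ?_
    rw [hrm.comap_apply, hsm.comap_apply, ← image_image (r : G → UnitSpace G) Subtype.val,
      ← image_image (s : G → UnitSpace G) Subtype.val]
    exact hμ _ (hUo.isOpenMap_subtype_val _ hA) (hU.mono (Subtype.coe_image_subset _ _))
  have h1 : range (fun u : U => (r (u : G) : UnitSpace G)) = r '' U := (image_eq_range _ _).symm
  have h2 : range (fun u : U => (s (u : G) : UnitSpace G)) = s '' U := (image_eq_range _ _).symm
  rw [← setIntegral_eq_integral_of_forall_compl_eq_zero hφ,
    ← setIntegral_eq_integral_of_forall_compl_eq_zero hψ, ← h1, ← h2, ← hrm.map_comap,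
    ← hsm.map_comap, hrm.integral_map, hsm.integral_map, hcomap]
  exact integral_congr_ae (.of_forall fun u => h u u.2)

theorem invol_add (f h : C_c(G, ℂ)) : invol (f + h) = invol f + invol h :=
  CompactlySupportedContinuousMap.ext fun γ => by
    rw [CompactlySupportedContinuousMap.add_apply]
    simp only [invol_apply, CompactlySupportedContinuousMap.add_apply, star_add]

theorem invol_zero : invol (0 : C_c(G, ℂ)) = 0 :=
  CompactlySupportedContinuousMap.ext fun _ => star_zero ℂ

section

variable {μ : Measure (UnitSpace G)} [IsProbabilityMeasure μ]

variable (μ) in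
/-- The embedding of `C(G⁽⁰⁾)` into `L²(μ)`. -/
noncomputable abbrev toL2 : C(UnitSpace G, ℂ) →L[ℂ] Lp ℂ 2 μ := ContinuousMap.toLp 2 μ ℂ

/-- For `f` on a bisection the two integrands live on `r(U)` and `s(U)` and agree along each arrow;
invariance of `μ` is what permits the change of variables without a density. -/
theorem IsGroupoidInvariant.inner_koopman (hμ : IsGroupoidInvariant μ) (f : C_c(G, ℂ))
    (ξ η : C(UnitSpace G, ℂ)) :
    inner ℂ (toL2 μ (koopman f ξ)) (toL2 μ η) =
      inner ℂ (toL2 μ ξ) (toL2 μ (koopman (invol f) η)) := by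
  induction f using cc_induction with
  | hz => rw [invol_zero, koopman_zero]; simp
  | ha f h hf hh =>
    rw [invol_add, koopman_add, koopman_add, LinearMap.add_apply, LinearMap.add_apply, map_add,
      map_add, inner_add_left, inner_add_right, hf, hh]
  | hs U hUo hUc hU f hf =>
    rw [ContinuousMap.inner_toLp, ContinuousMap.inner_toLp]
    refine hμ.integral_eq hUo hU (fun x hx => ?_) (fun x hx => ?_) fun g hg => ?_
    · rw [koopman_of_notMem hf _ hx, map_zero, mul_zero]
    · rw [koopman_of_notMem (invol_eq_zero hf) _ (by rwa [image_r_setInv]), zero_mul]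
    · rw [koopman_r hU hf _ hg, koopman_invol_s hU hf _ hg, map_mul, ← mul_assoc,
        mul_comm (η (r g))]
      rfl

/-- For `f` on a bisection, `T_{f^*} T_f` is multiplication by a function bounded by `sup |f|²`, and
`‖T_f ξ‖² = ⟨ξ, T_{f^*} T_f ξ⟩`. -/
theorem IsGroupoidInvariant.exists_norm_koopman_le (hμ : IsGroupoidInvariant μ) (f : C_c(G, ℂ)) :
    ∃ C : ℝ, ∀ ξ, ‖toL2 μ (koopman f ξ)‖ ≤ C * ‖toL2 μ ξ‖ := by
  induction f using cc_induction with
  | hz => exact ⟨0, fun ξ => by rw [koopman_zero]; simp⟩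
  | ha f h hf hh =>
    obtain ⟨C, hC⟩ := hf
    obtain ⟨D, hD⟩ := hh
    refine ⟨C + D, fun ξ => ?_⟩
    rw [koopman_add, LinearMap.add_apply, map_add, add_mul]
    exact (norm_add_le _ _).trans (add_le_add (hC ξ) (hD ξ))
  | hs U hUo hUc hU f hf =>
    obtain ⟨M, hM⟩ := f.hasCompactSupport.exists_bound_of_continuous f.1.continuous
    have hM0 : 0 ≤ |M| := abs_nonneg M
    refine ⟨|M|, fun ξ => ?_⟩
    have h1 : ‖toL2 μ (koopman (invol f) (koopman f ξ))‖ ≤ |M| ^ 2 * ‖toL2 μ ξ‖ := by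
      refine Lp.norm_le_mul_norm_of_ae_le_mul ?_
      filter_upwards [ContinuousMap.coeFn_toLp (p := 2) (𝕜 := ℂ) μ ξ, ContinuousMap.coeFn_toLp
        (p := 2) (𝕜 := ℂ) μ (koopman (invol f) (koopman f ξ))] with x hx hx'
      rw [hx, hx']
      by_cases h : x ∈ (s : G → UnitSpace G) '' U
      · obtain ⟨g, hg, rfl⟩ := h
        rw [koopman_invol_s hU hf _ hg, koopman_r hU hf _ hg, norm_mul, norm_mul, norm_star,
          ← mul_assoc, sq]
        have : ‖f g‖ ≤ |M| := (hM g).trans (le_abs_self M)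
        gcongr
      · rw [koopman_of_notMem (invol_eq_zero hf) _ (by rwa [image_r_setInv]), norm_zero]
        positivity
    have h2 : ‖toL2 μ (koopman f ξ)‖ ^ 2 ≤ ‖toL2 μ ξ‖ * (|M| ^ 2 * ‖toL2 μ ξ‖) := by
      rw [← inner_self_eq_norm_sq (𝕜 := ℂ), hμ.inner_koopman]
      exact (RCLike.re_le_norm _).trans ((norm_inner_le_norm _ _).trans (by gcongr))
    refine le_of_sq_le_sq (h2.trans_eq (by ring)) (by positivity)

variable [μ.Regular]

theorem denseRange_toL2 : DenseRange (toL2 μ) :=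
  ContinuousMap.toLp_denseRange ℂ μ ℂ (by simp)

theorem toL2_ext {A B : Lp ℂ 2 μ →L[ℂ] Lp ℂ 2 μ} (h : ∀ ξ, A (toL2 μ ξ) = B (toL2 μ ξ)) :
    A = B :=
  ContinuousLinearMap.ext fun v => congrFun (denseRange_toL2.equalizer A.continuous B.continuous
    (funext h)) v

variable (μ) in
/-- The extension of the operator `T_f` to `L²(μ)`. -/
noncomputable def koopmanL2 (f : C_c(G, ℂ)) : Lp ℂ 2 μ →L[ℂ] Lp ℂ 2 μ :=
  ((toL2 μ).toLinearMap.comp (koopman f)).extendOfNorm (toL2 μ).toLinearMap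

/-- The extension is meaningful only with a norm bound, which needs invariance, and with density of
`C(G⁽⁰⁾)` in `L²(μ)`, which needs regularity. -/
theorem IsGroupoidInvariant.koopmanL2_apply (hμ : IsGroupoidInvariant μ) (f : C_c(G, ℂ))
    (ξ : C(UnitSpace G, ℂ)) : koopmanL2 μ f (toL2 μ ξ) = toL2 μ (koopman f ξ) :=
  LinearMap.extendOfNorm_eq (e := (toL2 μ).toLinearMap) denseRange_toL2
    (hμ.exists_norm_koopman_le f) ξ

theorem IsGroupoidInvariant.koopmanL2_invol (hμ : IsGroupoidInvariant μ) (f : C_c(G, ℂ)) :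
    koopmanL2 μ (invol f) = star (koopmanL2 μ f) := by
  rw [ContinuousLinearMap.star_eq_adjoint]
  refine toL2_ext fun η => ?_
  rw [hμ.koopmanL2_apply]
  refine denseRange_toL2.eq_of_inner_right ℂ fun ξ => ?_
  rw [ContinuousLinearMap.adjoint_inner_right, hμ.koopmanL2_apply, hμ.inner_koopman]

theorem toL2_one_ne_zero : toL2 μ 1 ≠ 0 := by
  intro h
  have h1 := ContinuousMap.inner_toLp (𝕜 := ℂ) μ 1 1
  rw [show ContinuousMap.toLp 2 μ ℂ 1 = 0 from h] at h1
  simp at h1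

/-- The representation of `C_c(G)` on `L²(μ)`, for a `G`-invariant measure `μ`. -/
noncomputable def IsGroupoidInvariant.rep (hμ : IsGroupoidInvariant μ) : GroupoidRep G where
  space := Lp ℂ 2 μ
  nontrivial := ⟨_, _, toL2_one_ne_zero⟩
  toLinearMap :=
    { toFun := koopmanL2 μ
      map_add' := fun f h => toL2_ext fun ξ => by
        simp only [add_apply, hμ.koopmanL2_apply, koopman_add,
          LinearMap.add_apply, map_add]
      map_smul' := fun c f => toL2_ext fun ξ => by
        simp only [smul_apply, hμ.koopmanL2_apply, koopman_smul,
          LinearMap.smul_apply, map_smul, RingHom.id_apply] }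
  map_conv f h := toL2_ext fun ξ => by
    simp only [LinearMap.coe_mk, AddHom.coe_mk, mul_apply_eq_comp,
      hμ.koopmanL2_apply, koopman_conv]
  map_invol f := hμ.koopmanL2_invol f
  map_unit := toL2_ext fun ξ => by
    simp only [LinearMap.coe_mk, AddHom.coe_mk, one_apply_eq_self,
      hμ.koopmanL2_apply, koopman_unitFun]

end

/-- The extension of a representation of `C_c(G)` to `C*(G)`. -/
noncomputable def GroupoidRep.lift (ρ : GroupoidRep G) : FullCStarAlgebra G →ₗ[ℂ] ρ.Op where
  toFun a := (a : RepProduct G) ρ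
  map_add' _ _ := rfl
  map_smul' _ _ := rfl

theorem GroupoidRep.norm_lift_le (ρ : GroupoidRep G) (a : FullCStarAlgebra G) :
    ‖ρ.lift a‖ ≤ ‖a‖ :=
  lp.norm_apply_le_norm (by simp) (a : RepProduct G) ρ

/-- A common fixed vector is an eigenvector of each `∑ αᵢ ρ(1_{Uᵢ})` with eigenvalue `∑ αᵢ`, and an
eigenvalue is bounded by the operator norm. -/
theorem GroupoidRep.weaklyContains_trivialRep (ρ : GroupoidRep G) {v : ρ.space} (hv : v ≠ 0)
    (h : ∀ U : TopologicalFullGroup G, ρ.toLinearMap U.ind v = v) :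
    WeaklyContains (fullGroupRep G) (trivialRep (TopologicalFullGroup G)) := by
  intro a
  refine le_trans ?_ (ρ.norm_lift_le _)
  have h1 : ∀ U : TopologicalFullGroup G,
      ρ.lift (fullGroupRep G U : FullCStarAlgebra G) v = v := h
  have h2 : ρ.lift (a.sum fun U c => c • (fullGroupRep G U : FullCStarAlgebra G)) v =
      (a.sum fun U c => c • (trivialRep _ U : ℂ)) • v := by
    rw [Finsupp.sum, map_sum, sum_apply, Finsupp.sum, Finset.sum_smul]
    refine Finset.sum_congr rfl fun U _ => ?_
    rw [map_smul, smul_apply, h1]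
    simp [trivialRep]
  have h4 := (ρ.lift (a.sum fun U c =>
    c • (fullGroupRep G U : FullCStarAlgebra G))).le_opNorm v
  rw [h2, norm_smul] at h4
  exact le_of_mul_le_mul_right h4 (norm_pos_iff.2 hv)

theorem IsGroupoidInvariant.weaklyContains {μ : Measure (UnitSpace G)} [IsProbabilityMeasure μ]
    [μ.Regular] (hμ : IsGroupoidInvariant μ) :
    WeaklyContains (fullGroupRep G) (trivialRep (TopologicalFullGroup G)) :=
  hμ.rep.weaklyContains_trivialRep (v := toL2 μ 1) toL2_one_ne_zero fun U =>
    (hμ.koopmanL2_apply U.ind 1).trans (by rw [koopman_ind])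

end koopman

/-! ### Characters of the C*-algebra generated by a unitary representation -/

section characters

variable {Γ : Type u} [Group Γ] {A : Type v} [CStarAlgebra A] (σ : Γ →* unitary A)

theorem mem_generatedCStar (g : Γ) : (σ g : A) ∈ generatedCStar σ :=
  StarSubalgebra.le_topologicalClosure _ (StarAlgebra.subset_adjoin ℂ _ ⟨g, rfl⟩)

/-- A unitary representation as a map into the C*-algebra that it generates. -/
def toGenerated : Γ →* generatedCStar σ where
  toFun g := ⟨σ g, mem_generatedCStar σ g⟩
  map_one' := Subtype.ext (by simp)
  map_mul' g h := Subtype.ext (by simp)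

/-- The image of a group of unitaries is already closed under products and adjoints, so only linear
combinations have to be added. -/
theorem adjoin_range_le_span :
    (StarAlgebra.adjoin ℂ (Set.range fun g : Γ => (σ g : A)) : Set A) ⊆
      Submodule.span ℂ (Set.range fun g : Γ => (σ g : A)) := by
  intro x hx
  have h1 : x ∈ Subalgebra.toSubmodule
      (StarAlgebra.adjoin ℂ (Set.range fun g : Γ => (σ g : A))).toSubalgebra := hx
  rw [StarAlgebra.adjoin_eq_span] at h1
  refine Submodule.span_mono ?_ h1
  let M : Submonoid A := MonoidHom.mrange ((unitary A).subtype.comp σ)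
  have hM : Submonoid.closure ((Set.range fun g : Γ => (σ g : A)) ∪
      star (Set.range fun g : Γ => (σ g : A))) ≤ M := by
    rw [Submonoid.closure_le]
    rintro y (⟨g, rfl⟩ | ⟨g, hg⟩)
    · exact ⟨g, rfl⟩
    · refine ⟨g⁻¹, ?_⟩
      have : y = star (σ g : A) := by rw [← star_star y, ← hg]
      simp [this, ← Unitary.star_eq_inv]
  intro y hy
  exact hM hy

theorem dense_span_toGenerated :
    Dense (Submodule.span ℂ (Set.range (toGenerated σ)) : Set (generatedCStar σ)) := by
  refine Subtype.dense_iff.2 fun x hx => ?_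
  refine closure_mono ((adjoin_range_le_span σ).trans fun y hy => ?_) hx
  have : (Set.range fun g : Γ => (σ g : A)) =
      (generatedCStar σ).subtype.toLinearMap '' Set.range (toGenerated σ) := by
    rw [← range_comp]; rfl
  rw [this, ← Submodule.map_span] at hy
  exact hy

variable {σ}

theorem WeaklyContains.nonempty_characterSpace (h : WeaklyContains σ (trivialRep Γ)) :
    Nonempty (WeakDual.characterSpace ℂ (generatedCStar σ)) := by
  set e : (Γ →₀ ℂ) →ₗ[ℂ] generatedCStar σ := Finsupp.linearCombination ℂ (toGenerated σ) with he
  set f : (Γ →₀ ℂ) →ₗ[ℂ] ℂ := Finsupp.linearCombination ℂ (fun _ => (1 : ℂ)) with hf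
  have hdense : DenseRange e := by
    have := dense_span_toGenerated σ
    rwa [← Finsupp.range_linearCombination] at this
  have hnorm : ∀ a, ‖f a‖ ≤ 1 * ‖e a‖ := fun a => by
    rw [one_mul]
    have h1 : ‖e a‖ = ‖a.sum fun g c => c • (σ g : A)‖ := by
      change ‖((generatedCStar σ).subtype.toLinearMap (e a))‖ = _
      rw [he, Finsupp.linearCombination_apply, map_finsuppSum]
      rfl
    rw [h1]
    exact h a
  -- The map `e` need not be injective: the bound `hnorm` makes `f` descend to its range.
  set ψ : generatedCStar σ →L[ℂ] ℂ := f.extendOfNorm e with hψ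
  have hψg : ∀ g, ψ (toGenerated σ g) = 1 := fun g => by
    have h1 : toGenerated σ g = e (Finsupp.single g 1) := by simp [he]
    rw [h1, hψ, LinearMap.extendOfNorm_eq hdense ⟨1, hnorm⟩]
    simp [hf]
  -- Multiplicativity is extended from group elements by density in one variable at a time, here the
  -- right one and in `hmul` the left one.
  have hmul1 : ∀ g y, ψ (toGenerated σ g * y) = ψ y := fun g y => by
    have : ψ.comp (ContinuousLinearMap.mul ℂ _ (toGenerated σ g)) = ψ := by
      refine ContinuousLinearMap.ext_on (dense_span_toGenerated σ) ?_
      rintro _ ⟨k, rfl⟩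
      change ψ (toGenerated σ g * toGenerated σ k) = _
      rw [← map_mul, hψg, hψg]
    exact congrArg (fun F : generatedCStar σ →L[ℂ] ℂ => F y) this
  have hmul : ∀ x y, ψ (x * y) = ψ x * ψ y := fun x y => by
    have : ψ.comp ((ContinuousLinearMap.mul ℂ _).flip y) = ψ y • ψ := by
      refine ContinuousLinearMap.ext_on (dense_span_toGenerated σ) ?_
      rintro _ ⟨k, rfl⟩
      change ψ (toGenerated σ k * y) = ψ y * ψ (toGenerated σ k)
      rw [hmul1, hψg, mul_one]
    exact (congrArg (fun F : generatedCStar σ →L[ℂ] ℂ => F x) this).trans (mul_comm _ _)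
  refine ⟨⟨StrongDual.toWeakDual ψ, fun h0 => ?_, hmul⟩⟩
  have h1 := hψg 1
  rw [show ψ = 0 from h0] at h1
  exact zero_ne_one h1

/-- A character on the C*-algebra generated by a unitary representation extends to a contractive
functional. -/
theorem exists_extension_of_character (χ : WeakDual.characterSpace ℂ (generatedCStar σ)) :
    ∃ φ : A →L[ℂ] ℂ, ‖φ‖ ≤ 1 ∧ φ 1 = 1 ∧ ∀ g, ‖φ (σ g)‖ = 1 := by
  have hcl : IsClosed (generatedCStar σ : Set A) := StarSubalgebra.isClosed_topologicalClosure _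
  have : CompleteSpace (generatedCStar σ) := hcl.completeSpace_coe
  have hA : Nontrivial A := by
    by_contra hA
    rw [not_nontrivial_iff_subsingleton] at hA
    have : (1 : generatedCStar σ) = 0 := Subtype.ext (Subsingleton.elim _ _)
    exact one_ne_zero ((map_one χ).symm.trans ((congrArg χ this).trans (map_zero χ)))
  have hχ : ‖WeakDual.toStrongDual (χ : WeakDual ℂ (generatedCStar σ))‖ ≤ 1 := by
    refine (WeakDual.CharacterSpace.norm_le_norm_one χ).trans ?_
    change ‖(1 : A)‖ ≤ 1
    exact CStarRing.norm_one.le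
  obtain ⟨φ, hφ, hn⟩ := exists_extension_norm_eq
    (Subalgebra.toSubmodule (generatedCStar σ).toSubalgebra)
    (WeakDual.toStrongDual (χ : WeakDual ℂ (generatedCStar σ)))
  have hn1 : ‖φ‖ ≤ 1 := hn.trans_le hχ
  have hval : ∀ x : generatedCStar σ, φ (x : A) = χ x := hφ
  have hle : ∀ g, ‖φ (σ g)‖ ≤ 1 := fun g =>
    (φ.le_of_opNorm_le hn1 _).trans (by rw [CStarRing.norm_coe_unitary, one_mul])
  refine ⟨φ, hn1, (hval 1).trans (map_one χ), fun g => le_antisymm (hle g) ?_⟩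
  -- Two numbers of modulus at most one with product one both have modulus one.
  have h1 : φ (σ g) * φ (σ g⁻¹) = 1 := by
    rw [show (σ g : A) = (toGenerated σ g : A) from rfl,
      show (σ g⁻¹ : A) = (toGenerated σ g⁻¹ : A) from rfl, hval, hval, ← map_mul, ← map_mul,
      mul_inv_cancel, map_one, map_one]
  calc 1 = ‖φ (σ g)‖ * ‖φ (σ g⁻¹)‖ := by rw [← norm_mul, h1, norm_one]
    _ ≤ ‖φ (σ g)‖ * 1 := by gcongr; exact hle _
    _ = ‖φ (σ g)‖ := mul_one _

end characters

/-! ### Positivity of states and unitaries on which they have modulus one -/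

section states

open scoped ComplexOrder

variable {A : Type v} [CStarAlgebra A]

/-- For real `t`, `φ(a + it)` has imaginary part `Im φ(a) + t`, while `‖a + it‖² ≤ ‖a‖² + t²`. A
nonzero `Im φ(a)` would violate the resulting bound for suitable `t`. -/
theorem im_eq_zero_of_isSelfAdjoint {φ : A →L[ℂ] ℂ} (hφ : ‖φ‖ ≤ 1) (h1 : φ 1 = 1) {a : A}
    (ha : IsSelfAdjoint a) : (φ a).im = 0 := by
  have hA : Nontrivial A := ⟨1, 0, fun h => by simp [h] at h1⟩
  have key : ∀ t : ℝ, ((φ a).im + t) ^ 2 ≤ ‖a‖ ^ 2 + t ^ 2 := fun t => by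
    set b : A := a + ((t : ℂ) * Complex.I) • (1 : A) with hb
    have h2 : star b * b = a * a + ((t ^ 2 : ℝ) : ℂ) • (1 : A) := by
      have : star b = a - ((t : ℂ) * Complex.I) • (1 : A) := by
        rw [hb, star_add, star_smul, ha.star_eq, star_one]
        simp [sub_eq_add_neg]
      rw [this, hb]
      simp only [sub_mul, mul_add, smul_mul_assoc, mul_smul_comm, one_mul, mul_one, smul_sub, smul_smul]
      have : (t : ℂ) * Complex.I * ((t : ℂ) * Complex.I) = -((t ^ 2 : ℝ) : ℂ) := by
        push_cast
        linear_combination (t : ℂ) ^ 2 * Complex.I_sq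
      rw [this, neg_smul]
      abel
    have h3 : ‖b‖ ^ 2 ≤ ‖a‖ ^ 2 + t ^ 2 := by
      rw [sq, ← CStarRing.norm_star_mul_self, h2]
      refine (norm_add_le _ _).trans (add_le_add ?_ ?_)
      · rw [sq]; exact norm_mul_le _ _
      · rw [norm_smul, CStarRing.norm_one, mul_one, Complex.norm_real, Real.norm_eq_abs,
          abs_of_nonneg (sq_nonneg t)]
    have h4 : (φ b).im = (φ a).im + t := by
      rw [hb, map_add, map_smul, h1]; simp
    rw [← h4]
    have h5 : |(φ b).im| ≤ ‖b‖ :=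
      (Complex.abs_im_le_norm _).trans ((φ.le_of_opNorm_le hφ b).trans_eq (one_mul _))
    calc (φ b).im ^ 2 = |(φ b).im| ^ 2 := (sq_abs _).symm
      _ ≤ ‖b‖ ^ 2 := by gcongr
      _ ≤ _ := h3
  by_contra hne
  -- This `t` makes the cross term `2 t Im φ(a)` equal to `‖a‖² + 1`, which exceeds the `‖a‖²`
  -- allowed.
  have := key ((‖a‖ ^ 2 + 1) / (2 * (φ a).im))
  have h6 : 2 * (φ a).im * ((‖a‖ ^ 2 + 1) / (2 * (φ a).im)) = ‖a‖ ^ 2 + 1 := by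
    field_simp
  nlinarith [sq_nonneg (φ a).im]

variable [PartialOrder A] [StarOrderedRing A]

/-- From `0 ≤ a ≤ ‖a‖` one gets `‖‖a‖ - a‖ ≤ ‖a‖`, so `φ(a)` lies in the disc of radius `‖a‖` about
`‖a‖`. -/
theorem apply_nonneg_of_norm_le_one {φ : A →L[ℂ] ℂ} (hφ : ‖φ‖ ≤ 1) (h1 : φ 1 = 1) {a : A}
    (ha : 0 ≤ a) : 0 ≤ φ a := by
  refine Complex.nonneg_iff.2 ⟨?_, (im_eq_zero_of_isSelfAdjoint hφ h1 ha.isSelfAdjoint).symm⟩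
  have h2 : a ≤ algebraMap ℝ A ‖a‖ := ha.isSelfAdjoint.le_algebraMap_norm_self
  have h3 : ‖algebraMap ℝ A ‖a‖ - a‖ ≤ ‖a‖ :=
    (CStarAlgebra.norm_le_iff_le_algebraMap _ (norm_nonneg a) (sub_nonneg.2 h2)).2
      (sub_le_self _ ha)
  have h4 : φ (algebraMap ℝ A ‖a‖ - a) = ‖a‖ - φ a := by
    rw [map_sub, IsScalarTower.algebraMap_apply ℝ ℂ A, Algebra.algebraMap_eq_smul_one, map_smul,
      h1]
    simp
  have h5 : ‖(‖a‖ : ℂ) - φ a‖ ≤ ‖a‖ := by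
    rw [← h4]
    exact (φ.le_of_opNorm_le hφ _).trans ((one_mul _).trans_le h3)
  have h6 := (Complex.re_le_norm _).trans h5
  rw [Complex.sub_re, Complex.ofReal_re] at h6
  linarith

/-- This is Cauchy–Schwarz for the form `(a, b) ↦ f(a^* b)`, applied to `y^*` and `x`. -/
theorem PositiveLinearMap.apply_mul_eq_zero (f : A →ₚ[ℂ] ℂ) {x : A} (hx : f (star x * x) = 0)
    (y : A) : f (y * x) = 0 := by
  have h1 : ‖f.toPreGNS x‖ = 0 := by
    rw [f.preGNS_norm_def]
    simp [hx]
  have h2 := norm_inner_le_norm (𝕜 := ℂ) (f.toPreGNS (star y)) (f.toPreGNS x)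
  rw [h1, mul_zero, f.preGNS_inner_def] at h2
  simpa using h2

/-- With `c = f(u)`, the value of `f` at `(u - c)^*(u - c)` is `1 - |c|² = 0`, so `f(y(u - c)) = 0`.
-/
theorem PositiveLinearMap.apply_mul_unitary (f : A →ₚ[ℂ] ℂ) (h1 : f 1 = 1) (u : unitary A)
    (hu : ‖f (u : A)‖ = 1) (y : A) : f (y * u) = f y * f (u : A) := by
  set c := f (u : A) with hc
  have hcc : star c * c = 1 := by
    rw [Complex.star_def, ← Complex.normSq_eq_conj_mul_self, Complex.normSq_eq_norm_sq, hu]; simp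
  have h2 : star ((u : A) - c • (1 : A)) * ((u : A) - c • (1 : A)) =
      (1 + star c * c) • (1 : A) - c • star (u : A) - star c • (u : A) := by
    rw [star_sub, star_smul, star_one]
    simp only [sub_mul, mul_sub, smul_mul_assoc, mul_smul_comm, one_mul, mul_one, smul_sub,
      smul_smul, mul_comm c, Unitary.coe_star_mul_self, add_smul, one_smul]
    abel
  have h3 : f (star ((u : A) - c • (1 : A)) * ((u : A) - c • (1 : A))) = 0 := by
    rw [h2, map_sub, map_sub, map_smul, map_smul, map_smul, map_star f, h1, ← hc, smul_eq_mul,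
      smul_eq_mul, smul_eq_mul]
    linear_combination -hcc
  have h4 := f.apply_mul_eq_zero h3 y
  rw [mul_sub, map_sub, mul_smul_comm, mul_one, map_smul, smul_eq_mul, sub_eq_zero] at h4
  rw [h4, mul_comm]

theorem PositiveLinearMap.apply_unitary_mul (f : A →ₚ[ℂ] ℂ) (h1 : f 1 = 1) (u : unitary A)
    (hu : ‖f (u : A)‖ = 1) (y : A) : f (u * y) = f (u : A) * f y := by
  have hs : f ((star u : unitary A) : A) = star (f (u : A)) := by
    rw [Unitary.coe_star, map_star f]
  have h2 := f.apply_mul_unitary h1 (star u) (by rw [hs, norm_star, hu]) (star y)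
  rw [hs, Unitary.coe_star, ← star_mul, map_star f, map_star f, ← star_mul'] at h2
  rw [star_injective h2, mul_comm]

end states

/-! ### Consequences for states, with the spectral order introduced only inside proofs -/

section states

open scoped ComplexOrder

variable {A : Type v} [CStarAlgebra A]

theorem re_apply_star_mul_self_nonneg {φ : A →L[ℂ] ℂ} (hφ : ‖φ‖ ≤ 1) (h1 : φ 1 = 1) (x : A) :
    0 ≤ (φ (star x * x)).re := by
  let _ := CStarAlgebra.spectralOrder A
  have _ := CStarAlgebra.spectralOrderedRing A
  exact (Complex.nonneg_iff.1 (apply_nonneg_of_norm_le_one hφ h1 (star_mul_self_nonneg x))).1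

/-- A state that has modulus one at a unitary does not distinguish `u⁻¹yu` from `y`. -/
theorem apply_eq_of_unitary_intertwines {φ : A →L[ℂ] ℂ} (hφ : ‖φ‖ ≤ 1) (h1 : φ 1 = 1)
    (u : unitary A) (hu : ‖φ (u : A)‖ = 1) {x y : A} (h : u * x = y * u) : φ x = φ y := by
  let _ := CStarAlgebra.spectralOrder A
  have _ := CStarAlgebra.spectralOrderedRing A
  let f : A →ₚ[ℂ] ℂ :=
    .mk₀ φ.toLinearMap fun a ha => apply_nonneg_of_norm_le_one hφ h1 ha
  -- Evaluating gives `φ(u) φ(x) = φ(y) φ(u)`, and `φ(u) ≠ 0` can be cancelled.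
  have h2 := congrArg f h
  rw [f.apply_mul_unitary h1 _ hu, f.apply_unitary_mul h1 _ hu, mul_comm] at h2
  exact mul_right_cancel₀ (norm_ne_zero_iff.1 (hu.trans_ne one_ne_zero)) h2

end states

/-! ### Riesz representation on a compact space -/

section riesz

theorem exists_regular_probabilityMeasure {X : Type*} [TopologicalSpace X] [T2Space X]
    [CompactSpace X] [MeasurableSpace X] [BorelSpace X] (ψ : C(X, ℝ) →ₗ[ℝ] ℝ)
    (hpos : ∀ k, 0 ≤ k → 0 ≤ ψ k) (h1 : ψ 1 = 1) :
    ∃ μ : Measure X, IsProbabilityMeasure μ ∧ μ.Regular ∧ ∀ k : C(X, ℝ), ∫ x, k x ∂μ = ψ k := by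
  let Λ : C_c(X, ℝ) →ₚ[ℝ] ℝ := .mk₀
    { toFun := fun k => ψ k.toContinuousMap
      map_add' := fun k l => map_add ψ k.toContinuousMap l.toContinuousMap
      map_smul' := fun c k => map_smul ψ c k.toContinuousMap }
    fun k hk => hpos _ hk
  have hint : ∀ k : C(X, ℝ), ∫ x, k x ∂(RealRMK.rieszMeasure Λ) = ψ k := fun k =>
    RealRMK.integral_rieszMeasure Λ ⟨k, HasCompactSupport.of_compactSpace _⟩
  refine ⟨RealRMK.rieszMeasure Λ, ⟨?_⟩, inferInstance, hint⟩
  have h2 := hint 1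
  rw [h1] at h2
  simp only [ContinuousMap.one_apply, integral_const, smul_eq_mul, mul_one] at h2
  -- A real-valued mass of one also excludes infinite mass, whose `toReal` is zero.
  rwa [measureReal_def, ENNReal.toReal_eq_one_iff] at h2

end riesz

/-! ### From a character to an invariant measure -/

section invariantMeasure

variable {G : Type u} [TopologicalSpace G] [TopologicalGroupoid G] [AmpleGroupoid G]
  [CompactSpace (UnitSpace G)]

variable (G) in
/-- The inclusion of `C(G⁽⁰⁾)` into `C*(G)`. -/
noncomputable def unitsToFull : C(UnitSpace G, ℂ) →⋆ₙₐ[ℂ] FullCStarAlgebra G where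
  toFun k := toFull G (ofUnits k)
  map_smul' c k := Subtype.ext (lp.ext (funext fun ρ => map_smul (restrictUnits ρ) c k))
  map_zero' := Subtype.ext (lp.ext (funext fun ρ => map_zero (restrictUnits ρ)))
  map_add' k l := Subtype.ext (lp.ext (funext fun ρ => map_add (restrictUnits ρ) k l))
  map_mul' k l := Subtype.ext (lp.ext (funext fun ρ => map_mul (restrictUnits ρ) k l))
  map_star' k := Subtype.ext (lp.ext (funext fun ρ => map_star (restrictUnits ρ) k))

theorem unitsToFull_one : unitsToFull G 1 = 1 := by
  rw [← toFull_unit]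
  rfl

/-- Real-valued functions as complex-valued functions. -/
noncomputable def realToComplex (X : Type*) [TopologicalSpace X] : C(X, ℝ) →ₗ[ℝ] C(X, ℂ) where
  toFun k := ⟨fun x => (k x : ℂ), Complex.continuous_ofReal.comp k.continuous⟩
  map_add' k l := ContinuousMap.ext fun x => Complex.ofReal_add (k x) (l x)
  map_smul' c k := ContinuousMap.ext fun x => by simp

theorem realToComplex_apply {X : Type*} [TopologicalSpace X] (k : C(X, ℝ)) (x : X) :
    realToComplex X k x = (k x : ℂ) := rfl

/-- The pointwise square root serves as `l`. This form of positivity is carried by `*`-homomorphisms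
into `C*(G)`. -/
theorem realToComplex_eq_star_mul_self {X : Type*} [TopologicalSpace X] {k : C(X, ℝ)}
    (hk : 0 ≤ k) : ∃ l : C(X, ℂ), realToComplex X k = star l * l := by
  refine ⟨realToComplex X ⟨fun x => Real.sqrt (k x), k.continuous.sqrt⟩,
    ContinuousMap.ext fun x => ?_⟩
  rw [ContinuousMap.mul_apply, ContinuousMap.star_apply]
  simp only [realToComplex_apply, ContinuousMap.coe_mk, Complex.star_def, Complex.conj_ofReal]
  exact (congrArg Complex.ofReal (Real.mul_self_sqrt (hk x)).symm).trans (Complex.ofReal_mul _ _)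

/-- The covariance relation `1_U ⋆ (k ∘ θ_U) = k ⋆ 1_U`. -/
theorem TopologicalFullGroup.conv_ind_ofUnits (U : TopologicalFullGroup G)
    (k : C(UnitSpace G, ℂ)) :
    conv U.ind (ofUnits (k.comp ⟨U.theta, U.continuous_theta⟩)) = conv (ofUnits k) U.ind := by
  refine CompactlySupportedContinuousMap.ext fun γ => ?_
  have hz : ∀ x ∉ (units : Set G), ofUnits k x = 0 := fun x hx => indicator_of_notMem hx _
  rw [conv_apply, conv_apply, convFun_of_mem isBisection_units hz _ (r γ).2 (r_unit _), unit_inv,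
    unit_mul, ofUnits_apply, indicator_of_mem (r γ).2, r_unit]
  have hU : ∀ x ∉ U.carrier, U.ind x = 0 := fun x hx => indicator_of_notMem hx _
  obtain ⟨α, hα, hr⟩ := U.exists_r (r γ)
  rw [convFun_of_mem U.isBisection hU _ hα hr, ofUnits_apply]
  have h1 : U.ind α = 1 := indicator_of_mem hα _
  by_cases hγ : γ ∈ U.carrier
  · obtain rfl := U.isBisection.1 hα hγ hr
    rw [h1, inv_mul_eq, indicator_of_mem (s α).2, r_unit, one_mul, mul_one]
    exact congrArg k (U.theta_s hα)
  · rw [hU γ hγ, mul_zero, indicator_of_notMem, mul_zero]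
    -- If `α⁻¹γ` were a unit then `γ = α` would lie in `U`.
    intro h
    have h2 : α * (α⁻¹ * γ) = γ := inv_mul_cancel_left hr
    have h3 : (r (α⁻¹ * γ) : G) = α⁻¹ * γ := congrArg Subtype.val (r_unit ⟨_, h⟩)
    rw [r_mul _ _ ((s_inv α).trans hr), r_inv] at h3
    rw [← h3, mul_unit] at h2
    exact hγ (h2 ▸ hα)

theorem TopologicalFullGroup.bijective_theta (U : TopologicalFullGroup G) :
    Function.Bijective U.theta := by
  constructor
  · intro x y h
    obtain ⟨g, hg, rfl⟩ := U.exists_s x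
    obtain ⟨g', hg', rfl⟩ := U.exists_s y
    rw [U.theta_s hg, U.theta_s hg'] at h
    rw [U.isBisection.1 hg hg' h]
  · intro x
    obtain ⟨g, hg, rfl⟩ := U.exists_r x
    exact ⟨s g, U.theta_s hg⟩

/-- The homeomorphism `θ_U` carries `μ` to a regular measure, and regular measures are determined by
their integrals of continuous functions with compact support. -/
theorem isFullGroupInvariant_of_integral {μ : Measure (UnitSpace G)} [μ.Regular]
    (h : ∀ (U : TopologicalFullGroup G) (k : C(UnitSpace G, ℝ)),
      ∫ x, k (U.theta x) ∂μ = ∫ x, k x ∂μ) : IsFullGroupInvariant μ := by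
  intro U
  refine ⟨U.continuous_theta.measurable, ?_⟩
  have hθ : IsHomeomorph U.theta :=
    isHomeomorph_iff_continuous_bijective.2 ⟨U.continuous_theta, U.bijective_theta⟩
  have : (μ.map U.theta).Regular := Measure.Regular.map hθ.homeomorph
  refine Measure.ext_of_integral_eq_on_compactlySupported fun k => ?_
  rw [hθ.isClosedEmbedding.measurableEmbedding.integral_map]
  exact h U k.toContinuousMap

theorem exists_invariant_of_character
    (χ : WeakDual.characterSpace ℂ (generatedCStar (fullGroupRep G))) :
    ∃ μ : Measure (UnitSpace G), IsProbabilityMeasure μ ∧ μ.Regular ∧ IsFullGroupInvariant μ := by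
  obtain ⟨φ, hφ, h1, hg⟩ := exists_extension_of_character χ
  have hinv : ∀ (U : TopologicalFullGroup G) (k : C(UnitSpace G, ℂ)),
      φ (unitsToFull G (k.comp ⟨U.theta, U.continuous_theta⟩)) = φ (unitsToFull G k) := by
    intro U k
    refine apply_eq_of_unitary_intertwines hφ h1 _ (hg U) ?_
    change toFull G U.ind * toFull G (ofUnits _) = toFull G (ofUnits k) * toFull G U.ind
    rw [← toFull_conv, ← toFull_conv, U.conv_ind_ofUnits]
  -- Taking real parts gives a real functional without having to show that `φ` is real on
  -- real-valued functions.
  let ψ : C(UnitSpace G, ℝ) →ₗ[ℝ] ℝ :=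
    { toFun := fun k => (φ (unitsToFull G (realToComplex _ k))).re
      map_add' := fun k l => by simp only [map_add, Complex.add_re]
      map_smul' := fun c k => by
        have : realToComplex (UnitSpace G) (c • k) = (c : ℂ) • realToComplex _ k :=
          ContinuousMap.ext fun x => Complex.ofReal_mul c (k x)
        rw [this, map_smul, map_smul, smul_eq_mul, Complex.re_ofReal_mul, RingHom.id_apply,
          smul_eq_mul] }
  have hψ : ∀ k, ψ k = (φ (unitsToFull G (realToComplex _ k))).re := fun _ => rfl
  obtain ⟨μ, hμ, hreg, hint⟩ := exists_regular_probabilityMeasure ψ (fun k hk => by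
      obtain ⟨l, hl⟩ := realToComplex_eq_star_mul_self hk
      rw [hψ, hl, map_mul, map_star]
      exact re_apply_star_mul_self_nonneg hφ h1 _) (by
      have : realToComplex (UnitSpace G) 1 = 1 :=
        ContinuousMap.ext fun x => Complex.ofReal_one
      rw [hψ, this, unitsToFull_one, h1, Complex.one_re])
  refine ⟨μ, hμ, hreg, isFullGroupInvariant_of_integral fun U k => ?_⟩
  rw [hint k, hψ, ← hinv U]
  exact hint (k.comp ⟨U.theta, U.continuous_theta⟩)

end invariantMeasure

/-! ### The cycle of implications -/

theorem corollary3p6 (G : Type*) [TopologicalSpace G] [TopologicalGroupoid G] [AmpleGroupoid G]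
    [CompactSpace (UnitSpace G)] :
    List.TFAE [
      ∃ μ : Measure (UnitSpace G), IsProbabilityMeasure μ ∧ μ.Regular ∧ IsGroupoidInvariant μ,
      WeaklyContains (fullGroupRep G) (trivialRep (TopologicalFullGroup G)),
      Nonempty (WeakDual.characterSpace ℂ (generatedCStar (fullGroupRep G))),
      ∃ μ : Measure (UnitSpace G), IsProbabilityMeasure μ ∧ μ.Regular ∧
        IsFullGroupInvariant μ] := by
  tfae_have 1 → 2 := fun ⟨_, _, _, hμ⟩ => hμ.weaklyContains
  tfae_have 2 → 3 := WeaklyContains.nonempty_characterSpace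
  tfae_have 3 → 4 := fun ⟨χ⟩ => exists_invariant_of_character χ
  tfae_have 4 → 1 := fun ⟨μ, hp, hr, hμ⟩ => ⟨μ, hp, hr, hμ.isGroupoidInvariant⟩
  tfae_finish
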